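/- For $e\ge 0$ let $S_e$ be the space of binary forms of order $e$ over $\mathbb{C}$, i.e. homogeneous polynomials of degree $e$ in $x_0,x_1$. For $E\in S_e$, $F\in S_f$ and $0 \le r\le\min\{e,f\}$ the $r$-th transvectant is $$(E,F)_r=\frac{(e-r)!\,(f-r)!}{e!\,f!}\sum_{i=0}^r(-1)^i\binom ri\frac{\partial^rE}{\partial x_0^{r-i}\partial x_1^{i}}\,\frac{\partial^rF}{\partial x_0^{i}\partial x_1^{r-i}}\in S_{e+f-2r}.$$ Let $d\ge 3$. For $M\in S_{2d-2}$ and $N\in S_{2d-6}$ define the linear map $$\psi_{M,N}:S_d\to S_{3d-6},\qquad \psi_{M,N}(F)=(M,F)_2-\frac{d-2}{4d-6}\,N\,F .$$ For forms $F_1,\dots,F_d$ let $\Theta(F_1\wedge\dots\wedge F_d)$ be their Wronskian, the determinant of the $d\times d$ matrix with $(i,j)$ entry $\partial^{d-1}F_i/\partial x_0^{d-j}\partial x_1^{j-1}$. For $0\le i\le d$ put $$w_i=(-1)^i\,\Theta\Big(\bigwedge_{0\le s\le d,\ s\ne i}\psi_{M,N}(x_0^s x_1^{d-s})\Big)\in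 S_{d(2d-5)}$$ (factors in increasing order of $s$), and for $0\le r\le d$ $$\Phi_r(M,N)=\sum_{i=0}^d\,(w_i,\;x_0^i x_1^{d-i})_r .$$ For $A,B\in S_d$ let $\mathcal R(A,B)=\big(A(x)B(y)-B(x)A(y)\big)/\omega$ be the Bézoutiant, where $\omega=x_0y_1-x_1y_0$. For a form $E$ of even order $e$ let $E^{\mathrm{sym}}=\frac{(e/2)!}{e!}\big(y_0\tfrac{\partial}{\partial x_0}+y_1\tfrac{\partial}{\partial x_1}\big)^{e/2}E$, and let $c_r=2\binom{d}{2r+1}^2\big/\binom{2d-2r}{2r+1}$. **Theorem.** Let $d\ge3$. (a) For each $0\le r\le d$, $\Phi_r$ is a joint covariant of pairs of forms $(M,N)$ of orders $(2d-2,2d-6)$: $\Phi_r(M,N)$ is a form of order $d(2d-4)-2r$, its coefficients are homogeneous polynomials of total degree $d$ in the coefficients of $M$ and $N$, and $\Phi_r(gM,gN)=g\,\Phi_r(M,N)$ for all $g\in SL_2(\mathbb{C})$. (b) For $M\in S_{2d-2}$ with $M\neq0$ and $N\in S_{2d-6}$, the following are equivalent: (i) there exist linearly independent $A,B\in S_d$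 with $M=(A,B)_1$ and $N=(A,B)_3$; (ii) there exist linearly independent $A,B\in S_d$ such that $\mathcal R(A,B)-c_0\,M^{\mathrm{sym}}-c_1\,\omega^2N^{\mathrm{sym}}$ is divisible by $\omega^4$; (iii) $\dim\ker\big(\psi_{M,N}:S_d\to S_{3d-6}\big)\ge2$; (iv) $\Phi_r(M,N)=0$ for all $0\le r\le d$. Moreover, if $\dim\ker\psi_{M,N}\ge2$, then $\dim\ker\psi_{M,N}=2$. -/

import Mathlib

open MvPolynomial

noncomputable section

namespace BinaryForms

/-- The space `S_e` of binary forms of order `e` over `ℂ`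
(homogeneous polynomials of degree `e` in the variables `x₀, x₁`). -/
abbrev S (e : ℕ) : Submodule ℂ (MvPolynomial (Fin 2) ℂ) :=
  homogeneousSubmodule (Fin 2) ℂ e

/-- The differential operator `∂^(k+l) / ∂x₀^k ∂x₁^l`. -/
def partialD (k l : ℕ) : MvPolynomial (Fin 2) ℂ →ₗ[ℂ] MvPolynomial (Fin 2) ℂ :=
  ((pderiv (R := ℂ) (0 : Fin 2)).toLinearMap ^ k) ∘ₗ ((pderiv (R := ℂ) (1 : Fin 2)).toLinearMap ^ l)

/-- The `r`-th transvectant `(E, F)_r` of forms `E`, `F` of orders `e`, `f` (for `r ≤ e, f`):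
`(e-r)! (f-r)! / (e! f!) * ∑ i ≤ r, (-1)^i C(r,i) ∂^r E/∂x₀^(r-i)∂x₁^i * ∂^r F/∂x₀^i∂x₁^(r-i)`. -/
def transvectant (e f r : ℕ) (E F : MvPolynomial (Fin 2) ℂ) : MvPolynomial (Fin 2) ℂ :=
  ((((e - r).factorial : ℂ) * ((f - r).factorial : ℂ)) / ((e.factorial : ℂ) * (f.factorial : ℂ))) •
    ∑ i ∈ Finset.range (r + 1),
      ((-1 : ℂ) ^ i * (r.choose i : ℂ)) • (partialD (r - i) i E * partialD i (r - i) F)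

theorem partialD_mem {e : ℕ} (k l : ℕ) {E : MvPolynomial (Fin 2) ℂ} (hE : E ∈ S e) :
    partialD k l E ∈ S (e - (k + l)) := by
  have key : ∀ (i : Fin 2) (n m : ℕ) (G : MvPolynomial (Fin 2) ℂ), G ∈ S m →
      ((pderiv (R := ℂ) i).toLinearMap ^ n) G ∈ S (m - n) := by
    intro i n
    induction n with
    | zero => intro m G hG; simpa using hG
    | succ n ih =>
      intro m G hG
      rw [pow_succ']
      have h := (mem_homogeneousSubmodule _ _).1 (ih m G hG)
      have h2 : (pderiv i (((pderiv (R := ℂ) i).toLinearMap ^ n) G)).IsHomogeneous (m - n - 1) :=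
        h.pderiv
      rw [Nat.sub_sub] at h2
      exact (mem_homogeneousSubmodule _ _).2 h2
  have h := key 0 k _ _ (key 1 l _ _ hE)
  rwa [Nat.sub_sub, add_comm l k] at h

/-- The differential operator `ψ_{M,N} : S_d → S_{3d-6}`,
`F ↦ (M, F)_2 - (d-2)/(4d-6) * N * F`, for forms `M`, `N` of orders `2d-2`, `2d-6`. -/
def psi (d : ℕ) (hd : 3 ≤ d) (M : S (2 * d - 2)) (N : S (2 * d - 6)) :
    S d →ₗ[ℂ] S (3 * d - 6) where
  toFun F :=
    ⟨transvectant (2 * d - 2) d 2 M F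
        - (((d : ℂ) - 2) / (4 * (d : ℂ) - 6)) • ((N : MvPolynomial (Fin 2) ℂ) * F), by
      refine Submodule.sub_mem _ (Submodule.smul_mem _ _ (Submodule.sum_mem _ ?_))
        (Submodule.smul_mem _ _ ?_)
      · intro i hi
        have hi2 : i ≤ 2 := by simpa [Nat.lt_succ_iff] using hi
        refine Submodule.smul_mem _ _ ?_
        have h1 := (mem_homogeneousSubmodule _ _).1 (partialD_mem (2 - i) i M.2)
        have h2 := (mem_homogeneousSubmodule _ _).1 (partialD_mem i (2 - i) F.2)
        have h3 := h1.mul h2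
        rw [mem_homogeneousSubmodule]
        convert h3 using 1
        omega
      · have h3 := ((mem_homogeneousSubmodule _ _).1 N.2).mul
          ((mem_homogeneousSubmodule _ _).1 F.2)
        rw [mem_homogeneousSubmodule]
        convert h3 using 1
        omega⟩
  map_add' F G := by
    ext1
    simp only [transvectant, Submodule.coe_add, map_add, mul_add, smul_add,
      Finset.sum_add_distrib]
    abel
  map_smul' c F := by
    ext1
    simp only [transvectant, Submodule.coe_smul, map_smul, mul_smul_comm, RingHom.id_apply,
      smul_sub, Finset.smul_sum]
    congr 1
    · refine Finset.sum_congr rfl fun i _ => ?_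
      simp only [smul_smul]
      congr 1
      ring
    · simp only [smul_smul]
      congr 1
      ring

/-- The Wronskian `Θ(F₁ ∧ ⋯ ∧ F_q)`: the determinant with `(i, j)` entry
`∂^(q-1) F_i / ∂x₀^(q-j) ∂x₁^(j-1)`, `1 ≤ i, j ≤ q` (here indexed from `0`). -/
def wronskian {q : ℕ} (F : Fin q → MvPolynomial (Fin 2) ℂ) : MvPolynomial (Fin 2) ℂ :=
  Matrix.det (Matrix.of fun i j : Fin q => partialD (q - 1 - (j : ℕ)) (j : ℕ) (F i))

/-- The basis monomial `x₀^s x₁^(d-s)` of `S_d`. -/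
def basisForm (d : ℕ) (s : Fin (d + 1)) : S d :=
  ⟨X 0 ^ (s : ℕ) * X 1 ^ (d - (s : ℕ)), by
    rw [mem_homogeneousSubmodule]
    convert ((isHomogeneous_X ℂ (0 : Fin 2)).pow (s : ℕ)).mul
      ((isHomogeneous_X ℂ (1 : Fin 2)).pow (d - (s : ℕ))) using 1
    have := s.2
    omega⟩

/-- `w_i = (-1)^i Θ(⋀_{s ≠ i} ψ_{M,N}(x₀^s x₁^(d-s)))`, the factors in increasing order of `s`.

The tensor `∑ i, w_i ⊗ x₀^i x₁^(d-i)` is the image of `⋀^d ψ_{M,N}` under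
`Hom(⋀^d S_d, ⋀^d S_{3d-6}) ≃ ⋀^d S_{3d-6} ⊗ S_d → S_{d(2d-5)} ⊗ S_d`, where the dual of `⋀^d S_d`
is identified with `S_d` (uniquely up to a scalar, as `SL₂`-modules) by the wedge pairing
`S_d × ⋀^d S_d → ⋀^(d+1) S_d ≃ ℂ`: under it, the functional dual to
`⋀_{s ≠ i} x₀^s x₁^(d-s)` corresponds to `(-1)^i x₀^i x₁^(d-i)`. -/
def w (d : ℕ) (hd : 3 ≤ d) (M : S (2 * d - 2)) (N : S (2 * d - 6)) (i : Fin (d + 1)) :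
    MvPolynomial (Fin 2) ℂ :=
  (-1 : MvPolynomial (Fin 2) ℂ) ^ (i : ℕ) *
    wronskian fun s : Fin d =>
      (psi d hd M N (basisForm d (i.succAbove s)) : MvPolynomial (Fin 2) ℂ)

/-- `Φ_r(M, N) = ∑ i ≤ d, (w_i, x₀^i x₁^(d-i))_r`, the `w_i` being of order `d(2d-5)`. -/
def Phi (d : ℕ) (hd : 3 ≤ d) (r : ℕ) (M : S (2 * d - 2)) (N : S (2 * d - 6)) :
    MvPolynomial (Fin 2) ℂ :=
  ∑ i : Fin (d + 1), transvectant (d * (2 * d - 5)) d r (w d hd M N i) (basisForm d i)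

/-- The action of `g ∈ SL₂(ℂ)` on polynomials by the substitution `x_j ↦ ∑ i, g_{ij} x_i`. -/
def act (g : Matrix.SpecialLinearGroup (Fin 2) ℂ) :
    MvPolynomial (Fin 2) ℂ →ₐ[ℂ] MvPolynomial (Fin 2) ℂ :=
  aeval fun j : Fin 2 => ∑ i : Fin 2, C ((g : Matrix (Fin 2) (Fin 2) ℂ) i j) * X i

theorem act_mem (g : Matrix.SpecialLinearGroup (Fin 2) ℂ) {e : ℕ}
    {F : MvPolynomial (Fin 2) ℂ} (hF : F ∈ S e) : act g F ∈ S e := by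
  have h := ((mem_homogeneousSubmodule _ _).1 hF).aeval
    (fun j : Fin 2 => ∑ i : Fin 2, C ((g : Matrix (Fin 2) (Fin 2) ℂ) i j) * X i) (n := 1)
    (fun j => IsHomogeneous.sum _ _ _ fun i _ => isHomogeneous_C_mul_X _ _)
  rw [one_mul] at h
  exact (mem_homogeneousSubmodule _ _).2 h

/-- The action of `SL₂(ℂ)` on `S_e`. -/
def actS (g : Matrix.SpecialLinearGroup (Fin 2) ℂ) {e : ℕ} (F : S e) : S e :=
  ⟨act g F, act_mem g F.2⟩

/-- `Ψ` is a joint covariant, of degree `n` and order `m`, of pairs of forms of orders `a`, `b`: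
`Ψ(M, N)` is a form of order `m`, its coefficients are homogeneous polynomials of
(total) degree `n` in the coefficients of `M` and `N`, and `Ψ` is `SL₂`-equivariant. -/
structure IsJointCovariant (a b n m : ℕ) (Ψ : S a → S b → MvPolynomial (Fin 2) ℂ) : Prop where
  order : ∀ M N, Ψ M N ∈ S m
  degree : ∃ P : (Fin 2 →₀ ℕ) → MvPolynomial ((Fin 2 →₀ ℕ) ⊕ (Fin 2 →₀ ℕ)) ℂ,
    (∀ k, (P k).IsHomogeneous n) ∧
    ∀ (M : S a) (N : S b) (k : Fin 2 →₀ ℕ),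
      coeff k (Ψ M N) =
        eval (Sum.elim (fun l => coeff l (M : MvPolynomial (Fin 2) ℂ))
          (fun l => coeff l (N : MvPolynomial (Fin 2) ℂ))) (P k)
  equivariant : ∀ (g : Matrix.SpecialLinearGroup (Fin 2) ℂ) (M : S a) (N : S b),
    Ψ (actS g M) (actS g N) = act g (Ψ M N)

/-! Polynomials in two pairs of variables: `x_i = X (Sum.inl i)` and `y_i = X (Sum.inr i)`. -/

/-- `E(x)`. -/
def inX (E : MvPolynomial (Fin 2) ℂ) : MvPolynomial (Fin 2 ⊕ Fin 2) ℂ := rename Sum.inl E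

/-- `E(y)`. -/
def inY (E : MvPolynomial (Fin 2) ℂ) : MvPolynomial (Fin 2 ⊕ Fin 2) ℂ := rename Sum.inr E

/-- `ω = x₀ y₁ - x₁ y₀`. -/
def omega : MvPolynomial (Fin 2 ⊕ Fin 2) ℂ :=
  X (Sum.inl 0) * X (Sum.inr 1) - X (Sum.inl 1) * X (Sum.inr 0)

/-- The polarization operator `y₀ ∂/∂x₀ + y₁ ∂/∂x₁`. -/
def polarOp (P : MvPolynomial (Fin 2 ⊕ Fin 2) ℂ) : MvPolynomial (Fin 2 ⊕ Fin 2) ℂ :=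
  ∑ i : Fin 2, X (Sum.inr i) * pderiv (Sum.inl i) P

/-- The `m`-th polar `(e-m)!/e! (y₀ ∂/∂x₀ + y₁ ∂/∂x₁)^m E` of a form `E` of order `e`. -/
def polar (e m : ℕ) (E : MvPolynomial (Fin 2) ℂ) : MvPolynomial (Fin 2 ⊕ Fin 2) ℂ :=
  (((e - m).factorial : ℂ) / (e.factorial : ℂ)) • polarOp^[m] (inX E)

/-- The symmetric polarization (the `e/2`-th polar) of a form of even order `e`. -/
def symPolar {e : ℕ} (E : S e) : MvPolynomial (Fin 2 ⊕ Fin 2) ℂ := polar e (e / 2) E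

theorem omega_dvd {d : ℕ} (A B : S d) :
    omega ∣ inX (A : MvPolynomial (Fin 2) ℂ) * inY B - inX B * inY A := by
  have mono : ∀ a b : Fin 2 →₀ ℕ, a 0 + a 1 = d → b 0 + b 1 = d →
      omega ∣ inX (monomial a 1) * inY (monomial b 1)
        - inX (monomial b 1) * inY (monomial a 1) := by
    have main : ∀ a b : Fin 2 →₀ ℕ, a 0 + a 1 = d → b 0 + b 1 = d → b 0 ≤ a 0 →
        omega ∣ inX (monomial a 1) * inY (monomial b 1)
          - inX (monomial b 1) * inY (monomial a 1) := by
      intro a b ha hb hab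
      obtain ⟨k, hk⟩ := Nat.exists_eq_add_of_le hab
      have hb1 : b 1 = a 1 + k := by omega
      have e1 : ∀ c : Fin 2 →₀ ℕ, (monomial c (1 : ℂ)) = X 0 ^ c 0 * X 1 ^ c 1 := by
        intro c
        rw [monomial_eq, Finsupp.prod_fintype _ _ (by simp)]
        simp
      have h := sub_dvd_pow_sub_pow
        ((X (Sum.inl 0) * X (Sum.inr 1) : MvPolynomial (Fin 2 ⊕ Fin 2) ℂ))
        (X (Sum.inl 1) * X (Sum.inr 0)) k
      refine (h.mul_left ((X (Sum.inl 0) * X (Sum.inr 0)) ^ b 0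
        * (X (Sum.inl 1) * X (Sum.inr 1)) ^ a 1)).trans (dvd_of_eq ?_)
      simp only [inX, inY, e1, map_mul, map_pow, rename_X, hk, hb1]
      ring
    intro a b ha hb
    rcases le_total (b 0) (a 0) with h | h
    · exact main a b ha hb h
    · have := (main b a hb ha h).neg_right
      rwa [neg_sub] at this
  have supp : ∀ (F : S d) (a : Fin 2 →₀ ℕ), a ∈ (F : MvPolynomial (Fin 2) ℂ).support →
      a 0 + a 1 = d := by
    intro F a ha
    have h := ((mem_homogeneousSubmodule _ _).1 F.2) (mem_support_iff.1 ha)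
    rw [Finsupp.weight_apply, Finsupp.sum_fintype _ _ (by simp)] at h
    simpa using h
  have expand : ∀ F : S d, (F : MvPolynomial (Fin 2) ℂ) =
      ∑ a ∈ (F : MvPolynomial (Fin 2) ℂ).support,
        C (coeff a (F : MvPolynomial (Fin 2) ℂ)) * monomial a 1 := by
    intro F
    conv_lhs => rw [(F : MvPolynomial (Fin 2) ℂ).as_sum]
    simp [C_mul_monomial]
  have eX : ∀ F : S d, inX (F : MvPolynomial (Fin 2) ℂ) =
      ∑ a ∈ (F : MvPolynomial (Fin 2) ℂ).support,
        C (coeff a (F : MvPolynomial (Fin 2) ℂ)) * inX (monomial a 1) := by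
    intro F
    conv_lhs => rw [expand F]
    simp only [inX, map_sum, map_mul, rename_C]
  have eY : ∀ F : S d, inY (F : MvPolynomial (Fin 2) ℂ) =
      ∑ a ∈ (F : MvPolynomial (Fin 2) ℂ).support,
        C (coeff a (F : MvPolynomial (Fin 2) ℂ)) * inY (monomial a 1) := by
    intro F
    conv_lhs => rw [expand F]
    simp only [inY, map_sum, map_mul, rename_C]
  rw [mul_comm (inX (B : MvPolynomial (Fin 2) ℂ)), eX A, eY A, eX B, eY B, Finset.sum_mul_sum,
    Finset.sum_mul_sum, ← Finset.sum_sub_distrib]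
  refine Finset.dvd_sum fun a ha => ?_
  rw [← Finset.sum_sub_distrib]
  refine Finset.dvd_sum fun b hb => ?_
  refine ((mono a b (supp A a ha) (supp B b hb)).mul_left
    (C (coeff a (A : MvPolynomial (Fin 2) ℂ)) * C (coeff b (B : MvPolynomial (Fin 2) ℂ)))).trans
    (dvd_of_eq ?_)
  ring

/-- The Bézoutiant `R(A, B) = (A(x) B(y) - B(x) A(y)) / ω` of two forms of order `d`. -/
def bezoutiant {d : ℕ} (A B : S d) : MvPolynomial (Fin 2 ⊕ Fin 2) ℂ :=
  Classical.choose (omega_dvd A B)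

theorem omega_mul_bezoutiant {d : ℕ} (A B : S d) :
    omega * bezoutiant A B = inX (A : MvPolynomial (Fin 2) ℂ) * inY B - inX B * inY A :=
  (Classical.choose_spec (omega_dvd A B)).symm

/-- The constants `c_r = 2 C(d, 2r+1)² / C(2d-2r, 2r+1)`. -/
def cConst (d r : ℕ) : ℂ :=
  2 * (d.choose (2 * r + 1) : ℂ) ^ 2 / ((2 * d - 2 * r).choose (2 * r + 1) : ℂ)

end BinaryForms

end

noncomputable section

namespace BinaryForms

/-! ### Derivatives, Jacobians and Wronskians. -/

section Derivatives

variable {σ R : Type*} [CommRing R]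

/-! Two identities for forms `A`, `B` of order `d`, with nonzero constants, drive (i) ⇔ (iii). Up to
such factors, `((A,B)₁,A)₂` is `(A,B)₃ A` (`rawTransvectant_two_jacobian`), and `A (M,B)₂ - B
(M,A)₂` is `(M,(A,B)₁)₁` (`jacobian_of_rawTransvectant_two`). By the first, `A` and `B` lie in `ker
ψ` if `M = (A,B)₁` and `N = (A,B)₃`. Conversely, if `A`, `B` are independent in `ker ψ`, the second
identity loses its `N` terms and gives `(M,(A,B)₁)₁ = 0`. Forms of equal order with zero Jacobian
are proportional, so `A` can be rescaled to make `M = (A,B)₁`; the first identity then gives `N A =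
(A,B)₃ A`, and `A` cancels. For fixed `A ≠ 0` in the kernel, `F ↦ (A,F)₁` maps `ker ψ` to the line
`ℂM` and has kernel `ℂA`, so the dimension is at most 2.

For (i) ⇔ (ii), let `Ω` be Cayley's operator. A bihomogeneous `T(x,y)` is divisible by `ω^n` once
the diagonal restrictions of `Ω^r T`, `r < n`, vanish (`Bihom.omega_pow_dvd`). For the Bézoutiant
these restrictions are multiples of `(A,B)₁` and `(A,B)₃` at `r = 0, 2` and vanish at `r = 1, 3`;
`c₀` and `c₁` are the constants that match `M` and `N` with them.

For (iii) ⇔ (iv), a Wronskian vanishes exactly on dependent families, so `w_i = 0` says that `ker ψ`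
contains a nonzero vector with zero `i`-th coordinate; for all `i` together this means dimension at
least 2. The `Φ_r` are the transvectants of the tensor `∑ w_i(x) e_i(y)`. If they vanish for all `r
≤ d`, then `ω^(d+1)` divides a tensor of degree `d` in `y`, which is therefore zero.

For (a), the tensor is a determinant, and the changes of basis induced by `SL₂(ℂ)` have determinant
1 because the group is perfect (`det_actL`). -/

theorem pderiv_comm (i j : σ) (p : MvPolynomial σ R) :
    pderiv i (pderiv j p) = pderiv j (pderiv i p) := by
  classical
  have h : ⁅pderiv (R := R) i, pderiv (R := R) j⁆ = 0 := by
    refine MvPolynomial.derivation_ext fun k => ?_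
    rw [Derivation.commutator_apply]
    simp only [pderiv_X, Pi.single_apply]
    split_ifs <;> simp
  have h' := congrArg (fun D : Derivation R _ _ => D p) h
  rw [Derivation.commutator_apply] at h'
  exact sub_eq_zero.1 h'

theorem eq_C_of_pderiv_eq_zero [IsDomain R] [CharZero R] {p : MvPolynomial σ R}
    (h : ∀ i, pderiv i p = 0) : p = C (coeff 0 p) := by
  classical
  ext m
  rw [coeff_C]
  split_ifs with hm
  · rw [← hm]
  · obtain ⟨i, hi⟩ : ∃ i, m i ≠ 0 := by
      by_contra! hc
      exact hm (Finsupp.ext fun i => (hc i).symm)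
    have h1 := congrArg (coeff (m - Finsupp.single i 1)) (h i)
    rw [coeff_pderiv, coeff_zero, tsub_add_cancel_of_le
      (Finsupp.single_le_iff.2 (Nat.one_le_iff_ne_zero.2 hi))] at h1
    rcases mul_eq_zero.1 h1 with h2 | h2
    · exact h2
    · exact absurd h2 (Nat.cast_add_one_ne_zero _)

theorem totalDegree_pderiv_lt {p : MvPolynomial σ R} {i : σ} (h : pderiv i p ≠ 0) :
    (pderiv i p).totalDegree < p.totalDegree := by
  have hpos : ∀ b ∈ (pderiv i p).support, (b.sum fun _ e => e) < p.totalDegree := by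
    intro b hb
    rw [mem_support_iff, coeff_pderiv] at hb
    have h1 : b + Finsupp.single i 1 ∈ p.support :=
      mem_support_iff.2 (left_ne_zero_of_mul hb)
    have h2 := le_totalDegree h1
    rw [Finsupp.sum_add_index' (fun _ => rfl) (fun _ _ _ => rfl),
      Finsupp.sum_single_index rfl] at h2
    omega
  obtain ⟨b, hb⟩ := (pderiv i p).support_nonempty.2 h
  exact (Finset.sup_lt_iff (lt_of_le_of_lt (Nat.zero_le _) (hpos b hb))).2 hpos

/-- If all the Jacobians `p ∂q - q ∂p` vanish, then `q` is a scalar multiple of `p`. -/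
theorem exists_eq_C_mul {K : Type*} [Field K] [CharZero K] {p q : MvPolynomial σ K}
    (hp : p ≠ 0) (h : ∀ i, p * pderiv i q = q * pderiv i p) : ∃ c : K, q = C c * p := by
  -- The relation is homogeneous in `(p, q)`, so a common factor `g` can be divided out.
  obtain ⟨p', q', g, hrel, rfl, rfl⟩ := UniqueFactorizationMonoid.exists_reduced_factors p hp q
  have hg : g ≠ 0 := left_ne_zero_of_mul hp
  have hp' : p' ≠ 0 := right_ne_zero_of_mul hp
  have h' : ∀ i, p' * pderiv i q' = q' * pderiv i p' := by
    intro i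
    have h1 := h i
    rw [pderiv_mul, pderiv_mul] at h1
    refine mul_left_cancel₀ (mul_ne_zero hg hg) ?_
    linear_combination h1
  have hdp : ∀ i, pderiv i p' = 0 := by
    intro i
    by_contra hne
    -- Coprimality makes `p'` divide its own derivative, which has smaller degree.
    obtain ⟨s, hs⟩ := hrel.dvd_of_dvd_mul_left (Dvd.intro _ (h' i))
    have h1 := totalDegree_pderiv_lt hne
    have hs0 : s ≠ 0 := by rintro rfl; exact hne (by simpa using hs)
    rw [hs, totalDegree_mul_of_isDomain hp' hs0] at h1
    omega
  have hdq : ∀ i, pderiv i q' = 0 := by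
    intro i
    have h1 := h' i
    rw [hdp i, mul_zero] at h1
    exact (mul_eq_zero.1 h1).resolve_left hp'
  rw [eq_C_of_pderiv_eq_zero hdp] at hp' ⊢
  rw [eq_C_of_pderiv_eq_zero hdq]
  have hc : coeff 0 p' ≠ 0 := by simpa using hp'
  refine ⟨coeff 0 q' / coeff 0 p', ?_⟩
  rw [mul_left_comm, ← C_mul, div_mul_cancel₀ _ hc]

end Derivatives

theorem partialD_zero_zero (F : MvPolynomial (Fin 2) ℂ) : partialD 0 0 F = F := by
  simp [partialD]

theorem pderiv_zero_partialD (k l : ℕ) (F : MvPolynomial (Fin 2) ℂ) :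
    pderiv 0 (partialD k l F) = partialD (k + 1) l F := by
  simp [partialD, pow_succ']

theorem pderiv_one_partialD (k l : ℕ) (F : MvPolynomial (Fin 2) ℂ) :
    pderiv 1 (partialD k l F) = partialD k (l + 1) F := by
  have hc : Commute (pderiv (R := ℂ) (1 : Fin 2)).toLinearMap
      (pderiv (R := ℂ) (0 : Fin 2)).toLinearMap :=
    LinearMap.ext fun p => pderiv_comm 1 0 p
  have h := LinearMap.congr_fun (hc.pow_right k).eq
    (((pderiv (R := ℂ) (1 : Fin 2)).toLinearMap ^ l) F)
  simp only [Module.End.mul_apply] at h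
  simpa [partialD, pow_succ'] using h

theorem euler_partialD {m : ℕ} {F : MvPolynomial (Fin 2) ℂ} (hF : F ∈ S m) (k l : ℕ) :
    X 0 * partialD (k + 1) l F + X 1 * partialD k (l + 1) F =
      C ((m - (k + l) : ℕ) : ℂ) * partialD k l F := by
  have h := ((mem_homogeneousSubmodule _ _).1 (partialD_mem k l hF)).sum_X_mul_pderiv
  rw [Fin.sum_univ_two, pderiv_zero_partialD, pderiv_one_partialD] at h
  rw [h, nsmul_eq_mul, map_natCast]

/-- A linear relation among the derivatives of order `n ≤ m` of forms of order `m` holds for the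
forms themselves. -/
theorem sum_mul_eq_zero_of_partialD {q m n : ℕ} (hn : n ≤ m) {F : Fin q → S m}
    {c : Fin q → MvPolynomial (Fin 2) ℂ}
    (h : ∀ k l, k + l = n → ∑ i, c i * partialD k l (F i : MvPolynomial (Fin 2) ℂ) = 0)
    (k l : ℕ) (hkl : k + l ≤ n) : ∑ i, c i * partialD k l (F i : MvPolynomial (Fin 2) ℂ) = 0 := by
  obtain ⟨t, ht⟩ := Nat.exists_eq_add_of_le hkl
  induction t generalizing k l with
  | zero => exact h k l (by omega)
  | succ t ih =>
    have h0 := ih (k + 1) l (by omega) (by omega)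
    have h1 := ih k (l + 1) (by omega) (by omega)
    -- Euler's formula recovers a derivative from those one order higher, up to its degree; that
    -- degree is nonzero because `k + l < n ≤ m`.
    have hc : (C ((m - (k + l) : ℕ) : ℂ) : MvPolynomial (Fin 2) ℂ) ≠ 0 := by
      rw [Ne, C_eq_zero, Nat.cast_eq_zero]
      omega
    refine (mul_eq_zero.1 ?_).resolve_left hc
    calc _ = ∑ i, c i * (C ((m - (k + l) : ℕ) : ℂ) *
          partialD k l (F i : MvPolynomial (Fin 2) ℂ)) := by
          rw [Finset.mul_sum]; exact Finset.sum_congr rfl fun i _ => by ring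
      _ = X 0 * ∑ i, c i * partialD (k + 1) l (F i : MvPolynomial (Fin 2) ℂ) +
          X 1 * ∑ i, c i * partialD k (l + 1) (F i : MvPolynomial (Fin 2) ℂ) := by
          rw [Finset.mul_sum, Finset.mul_sum, ← Finset.sum_add_distrib]
          refine Finset.sum_congr rfl fun i _ => ?_
          rw [← euler_partialD (F i).2]
          ring
      _ = 0 := by rw [h0, h1]; ring

/-- The Wronskian of linearly independent forms does not vanish. -/
theorem wronskian_ne_zero {q m : ℕ} (hq : q ≤ m + 1) {F : Fin q → S m}
    (hF : LinearIndependent ℂ F) :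
    wronskian (fun i => (F i : MvPolynomial (Fin 2) ℂ)) ≠ 0 := by
  induction q with
  | zero => simp [wronskian]
  | succ q ih =>
    intro hdet
    -- A zero determinant yields a relation with polynomial coefficients `c`; the rest of the proof
    -- shows that the ratios `c i / c 0` are constant.
    obtain ⟨c, hc0, hc⟩ := Matrix.exists_vecMul_eq_zero_iff.2 hdet
    have hrel : ∀ k l, k + l = q →
        ∑ i, c i * partialD k l (F i : MvPolynomial (Fin 2) ℂ) = 0 := by
      intro k l hkl
      have h1 := congrFun hc ⟨l, by omega⟩
      simp only [Matrix.vecMul, dotProduct, Matrix.of_apply, Pi.zero_apply] at h1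
      rw [← h1]
      refine Finset.sum_congr rfl fun i _ => ?_
      rw [show q + 1 - 1 - l = k by omega]
    have hlow := sum_mul_eq_zero_of_partialD (n := q) (by omega) hrel
    -- The induction hypothesis for the last `q` forms, in relation form.
    have htail : ∀ b : Fin q → MvPolynomial (Fin 2) ℂ,
        (∀ k l, k + l + 1 = q →
          ∑ i, b i * partialD k l (F i.succ : MvPolynomial (Fin 2) ℂ) = 0) → b = 0 := by
      intro b hb
      by_contra hb0
      refine ih (by omega) (hF.comp Fin.succ (Fin.succ_injective _))
        (Matrix.exists_vecMul_eq_zero_iff.1 ⟨b, hb0, ?_⟩)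
      ext1 j
      have h1 := hb (q - 1 - j) j (by omega)
      simpa only [Matrix.vecMul, dotProduct, Matrix.of_apply, Pi.zero_apply, Function.comp_apply]
        using h1
    have hc00 : c 0 ≠ 0 := by
      intro h0
      refine hc0 (funext fun i => ?_)
      refine Fin.cases h0 (fun i => ?_) i
      refine congrFun (htail (fun i => c i.succ) fun k l hkl => ?_) i
      have h1 := hlow k l (by omega)
      rwa [Fin.sum_univ_succ, h0, zero_mul, zero_add] at h1
    -- Differentiating a relation of order `q - 1` leaves only the terms with `∂c`, since the others
    -- form a relation of order `q`.
    have hder : ∀ (t : Fin 2) (k l), k + l + 1 = q →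
        ∑ i, pderiv t (c i) * partialD k l (F i : MvPolynomial (Fin 2) ℂ) = 0 := by
      intro t k l hkl
      have h1 := congrArg (pderiv t) (hlow k l (by omega))
      simp only [map_sum, pderiv_mul, Finset.sum_add_distrib, map_zero] at h1
      have h2 : ∑ i, c i * pderiv t (partialD k l (F i : MvPolynomial (Fin 2) ℂ)) = 0 := by
        fin_cases t
        · simp only [Fin.zero_eta, pderiv_zero_partialD]
          exact hlow _ _ (by omega)
        · simp only [Fin.mk_one, pderiv_one_partialD]
          exact hlow _ _ (by omega)
      rwa [h2, add_zero] at h1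
    -- Eliminating `F 0` between the relations for `c` and `∂c` leaves a relation among the last `q`
    -- forms.
    have hprop : ∀ (t : Fin 2) (i : Fin q),
        c 0 * pderiv t (c i.succ) = c i.succ * pderiv t (c 0) := by
      intro t i
      have h1 := congrFun (htail
        (fun i => c 0 * pderiv t (c i.succ) - c i.succ * pderiv t (c 0)) fun k l hkl => ?_) i
      · exact sub_eq_zero.1 h1
      · have h1 := hlow k l (by omega)
        have h2 := hder t k l hkl
        rw [Fin.sum_univ_succ] at h1 h2
        simp only [sub_mul, Finset.sum_sub_distrib, mul_assoc]
        simp only [mul_left_comm _ (pderiv t (c 0)), ← Finset.mul_sum]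
        linear_combination (c 0) * h2 - (pderiv t (c 0)) * h1
    have hex : ∀ i, ∃ a : ℂ, c i = C a * c 0 := by
      intro i
      refine Fin.cases ⟨1, by simp⟩ (fun i => ?_) i
      exact exists_eq_C_mul hc00 fun t => hprop t i
    choose a ha using hex
    have h0 := hlow 0 0 (Nat.zero_le _)
    have h1 : c 0 * ∑ i, a i • (F i : MvPolynomial (Fin 2) ℂ) = 0 := by
      rw [← h0, Finset.mul_sum]
      refine Finset.sum_congr rfl fun i _ => ?_
      rw [ha i, partialD_zero_zero, smul_eq_C_mul]
      ring
    have h2 : ∑ i, a i • F i = 0 := by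
      ext1
      simpa using (mul_eq_zero.1 h1).resolve_left hc00
    have h3 := Fintype.linearIndependent_iff.1 hF a h2 0
    refine hc00 ?_
    rw [ha 0, h3]
    simp

/-- The Wronskian of linearly dependent forms vanishes. -/
theorem wronskian_eq_zero {q : ℕ} {F : Fin q → MvPolynomial (Fin 2) ℂ} {a : Fin q → ℂ}
    (ha : a ≠ 0) (h : ∑ i, a i • F i = 0) : wronskian F = 0 := by
  obtain ⟨i, hi⟩ := Function.ne_iff.1 ha
  refine Matrix.exists_vecMul_eq_zero_iff.1 ⟨fun i => C (a i), ?_, ?_⟩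
  · intro h0
    exact hi (by simpa using congrFun h0 i)
  · ext1 j
    have h1 := congrArg (partialD (q - 1 - j) j) h
    simpa [Matrix.vecMul, dotProduct, ← smul_eq_C_mul] using h1

/-! ### Cayley's operator, powers of `ω` and restriction to the diagonal. -/

section

/-- Cayley's operator `∂²/∂x₀∂y₁ - ∂²/∂x₁∂y₀`. -/
def cayley : MvPolynomial (Fin 2 ⊕ Fin 2) ℂ →ₗ[ℂ] MvPolynomial (Fin 2 ⊕ Fin 2) ℂ :=
  (pderiv (Sum.inl 0)).toLinearMap ∘ₗ (pderiv (Sum.inr 1)).toLinearMap -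
    (pderiv (Sum.inl 1)).toLinearMap ∘ₗ (pderiv (Sum.inr 0)).toLinearMap

theorem cayley_apply (T : MvPolynomial (Fin 2 ⊕ Fin 2) ℂ) :
    cayley T = pderiv (Sum.inl 0) (pderiv (Sum.inr 1) T) -
      pderiv (Sum.inl 1) (pderiv (Sum.inr 0) T) := rfl

/-- The Euler operator in the variables `x`. -/
def eulerX : Derivation ℂ (MvPolynomial (Fin 2 ⊕ Fin 2) ℂ) (MvPolynomial (Fin 2 ⊕ Fin 2) ℂ) :=
  (X (Sum.inl 0) : MvPolynomial (Fin 2 ⊕ Fin 2) ℂ) • pderiv (Sum.inl 0) +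
    (X (Sum.inl 1) : MvPolynomial (Fin 2 ⊕ Fin 2) ℂ) • pderiv (Sum.inl 1)

/-- The Euler operator in the variables `y`. -/
def eulerY : Derivation ℂ (MvPolynomial (Fin 2 ⊕ Fin 2) ℂ) (MvPolynomial (Fin 2 ⊕ Fin 2) ℂ) :=
  (X (Sum.inr 0) : MvPolynomial (Fin 2 ⊕ Fin 2) ℂ) • pderiv (Sum.inr 0) +
    (X (Sum.inr 1) : MvPolynomial (Fin 2 ⊕ Fin 2) ℂ) • pderiv (Sum.inr 1)

theorem eulerX_apply (T : MvPolynomial (Fin 2 ⊕ Fin 2) ℂ) :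
    eulerX T = X (Sum.inl 0) * pderiv (Sum.inl 0) T + X (Sum.inl 1) * pderiv (Sum.inl 1) T := rfl

theorem eulerY_apply (T : MvPolynomial (Fin 2 ⊕ Fin 2) ℂ) :
    eulerY T = X (Sum.inr 0) * pderiv (Sum.inr 0) T + X (Sum.inr 1) * pderiv (Sum.inr 1) T := rfl

/-- Restriction to the diagonal `y = x`. -/
def diag : MvPolynomial (Fin 2 ⊕ Fin 2) ℂ →ₐ[ℂ] MvPolynomial (Fin 2) ℂ :=
  aeval (Sum.elim X X)

theorem omega_ne_zero : omega ≠ 0 := by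
  intro h
  have h1 := congrArg (eval (Sum.elim ![1, 0] ![0, 1])) h
  simp [omega] at h1

theorem diag_omega : diag omega = 0 := by
  simp [diag, omega, mul_comm]

/-- The commutator of `cayley` and multiplication by `ω` is `eulerX + eulerY + 2`: up to signs, an
`sl₂`-triple. All constants in the Gordan series come from it. -/
theorem cayley_omega_mul (G : MvPolynomial (Fin 2 ⊕ Fin 2) ℂ) :
    cayley (omega * G) = omega * cayley G + eulerX G + eulerY G + 2 * G := by
  simp only [cayley_apply, eulerX_apply, eulerY_apply, omega, pderiv_mul, map_sub, map_add,
    pderiv_X, Pi.single_apply, Sum.inl.injEq, Sum.inr.injEq, reduceCtorEq, if_true, if_false,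
    zero_ne_one, one_ne_zero, map_zero, pderiv_one]
  ring

theorem eulerX_omega : eulerX omega = omega := by
  simp [eulerX_apply, omega, pderiv_X]
  ring

theorem eulerY_omega : eulerY omega = omega := by
  simp [eulerY_apply, omega, pderiv_X]
  ring

theorem eulerX_cayley (G : MvPolynomial (Fin 2 ⊕ Fin 2) ℂ) :
    eulerX (cayley G) = cayley (eulerX G) - cayley G := by
  simp only [cayley_apply, eulerX_apply, pderiv_mul, map_sub, map_add, pderiv_X, Pi.single_apply,
    Sum.inl.injEq, reduceCtorEq, if_true, if_false, zero_ne_one, one_ne_zero, map_zero,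
    pderiv_comm (Sum.inr _) (Sum.inl _)]
  linear_combination
    X (Sum.inl 1) * pderiv_comm (Sum.inl 1) (Sum.inl 0) (pderiv (Sum.inr 1) G) -
      X (Sum.inl 0) * pderiv_comm (Sum.inl 0) (Sum.inl 1) (pderiv (Sum.inr 0) G)

theorem eulerY_cayley (G : MvPolynomial (Fin 2 ⊕ Fin 2) ℂ) :
    eulerY (cayley G) = cayley (eulerY G) - cayley G := by
  simp only [cayley_apply, eulerY_apply, pderiv_mul, map_sub, map_add, pderiv_X, Pi.single_apply,
    Sum.inr.injEq, reduceCtorEq, if_true, if_false, zero_ne_one, one_ne_zero, map_zero,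
    pderiv_one, pderiv_comm (Sum.inr _) (Sum.inl _)]
  linear_combination
    X (Sum.inr 0) * congrArg (pderiv (Sum.inl 0)) (pderiv_comm (Sum.inr 0) (Sum.inr 1) G) -
      X (Sum.inr 1) * congrArg (pderiv (Sum.inl 1)) (pderiv_comm (Sum.inr 1) (Sum.inr 0) G)

/-- `T` is bihomogeneous of bidegree `(a, b)`, in terms of the Euler operators. -/
structure Bihom (a b : ℂ) (T : MvPolynomial (Fin 2 ⊕ Fin 2) ℂ) : Prop where
  left : eulerX T = a • T
  right : eulerY T = b • T

namespace Bihom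

variable {a b a' b' : ℂ} {T U : MvPolynomial (Fin 2 ⊕ Fin 2) ℂ}

theorem congr (h : Bihom a b T) (ha : a = a') (hb : b = b') : Bihom a' b' T := ha ▸ hb ▸ h

theorem add (hT : Bihom a b T) (hU : Bihom a b U) : Bihom a b (T + U) :=
  ⟨by rw [map_add, hT.left, hU.left, smul_add], by rw [map_add, hT.right, hU.right, smul_add]⟩

theorem smul (hT : Bihom a b T) (c : ℂ) : Bihom a b (c • T) :=
  ⟨by rw [Derivation.map_smul, hT.left, smul_comm],
    by rw [Derivation.map_smul, hT.right, smul_comm]⟩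

theorem sub (hT : Bihom a b T) (hU : Bihom a b U) : Bihom a b (T - U) :=
  ⟨by rw [map_sub, hT.left, hU.left, smul_sub], by rw [map_sub, hT.right, hU.right, smul_sub]⟩

theorem sum {ι : Type*} {s : Finset ι} {T : ι → MvPolynomial (Fin 2 ⊕ Fin 2) ℂ}
    (h : ∀ i ∈ s, Bihom a b (T i)) : Bihom a b (∑ i ∈ s, T i) :=
  ⟨by rw [map_sum, Finset.smul_sum]; exact Finset.sum_congr rfl fun i hi => (h i hi).left,
    by rw [map_sum, Finset.smul_sum]; exact Finset.sum_congr rfl fun i hi => (h i hi).right⟩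

theorem mul (hT : Bihom a b T) (hU : Bihom a' b' U) : Bihom (a + a') (b + b') (T * U) :=
  ⟨by rw [Derivation.leibniz, hT.left, hU.left]; simp only [smul_eq_C_mul, smul_eq_mul, C_add]; ring,
    by rw [Derivation.leibniz, hT.right, hU.right]
       simp only [smul_eq_C_mul, smul_eq_mul, C_add]; ring⟩

theorem cayley (h : Bihom a b T) : Bihom (a - 1) (b - 1) (cayley T) :=
  ⟨by rw [eulerX_cayley, h.left, map_smul, sub_smul, one_smul],
    by rw [eulerY_cayley, h.right, map_smul, sub_smul, one_smul]⟩

theorem of_omega_mul (h : Bihom a b (omega * T)) : Bihom (a - 1) (b - 1) T := by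
  constructor
  · refine mul_left_cancel₀ omega_ne_zero ?_
    have h1 := h.left
    rw [Derivation.leibniz, eulerX_omega] at h1
    simp only [smul_eq_C_mul, smul_eq_mul, C_sub, C_1] at h1 ⊢
    linear_combination h1
  · refine mul_left_cancel₀ omega_ne_zero ?_
    have h1 := h.right
    rw [Derivation.leibniz, eulerY_omega] at h1
    simp only [smul_eq_C_mul, smul_eq_mul, C_sub, C_1] at h1 ⊢
    linear_combination h1

end Bihom

theorem bihom_omega : Bihom 1 1 omega :=
  ⟨by rw [eulerX_omega, one_smul], by rw [eulerY_omega, one_smul]⟩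

theorem cayley_omega_mul_of_bihom {a b : ℂ} {G : MvPolynomial (Fin 2 ⊕ Fin 2) ℂ}
    (h : Bihom a b G) : cayley (omega * G) = omega * cayley G + (a + b + 2) • G := by
  rw [cayley_omega_mul, h.left, h.right]
  simp only [smul_eq_C_mul, C_add, map_ofNat]
  ring

/-- Each application of `cayley` lowers the total bidegree by 2, so the coefficient is the sum of `a
+ b + 2 - 2j` over `0 ≤ j ≤ n`. -/
theorem cayley_pow_omega_mul (n : ℕ) {a b : ℂ} {G : MvPolynomial (Fin 2 ⊕ Fin 2) ℂ}
    (h : Bihom a b G) : (cayley ^ (n + 1)) (omega * G) =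
      omega * (cayley ^ (n + 1)) G + ((n + 1 : ℂ) * (a + b + 2 - n)) • (cayley ^ n) G := by
  induction n generalizing a b G with
  | zero => simpa using cayley_omega_mul_of_bihom h
  | succ n ih =>
    rw [pow_succ, Module.End.mul_apply, cayley_omega_mul_of_bihom h, map_add, ih h.cayley, map_smul]
    simp only [pow_succ _ n, Module.End.mul_apply, add_assoc, ← add_smul]
    congr 2
    push_cast
    ring

theorem diag_cayley_pow_omega_mul (n : ℕ) {a b : ℂ} {G : MvPolynomial (Fin 2 ⊕ Fin 2) ℂ}
    (h : Bihom a b G) : diag ((cayley ^ (n + 1)) (omega * G)) =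
      ((n + 1 : ℂ) * (a + b + 2 - n)) • diag ((cayley ^ n) G) := by
  rw [cayley_pow_omega_mul n h, map_add, map_mul, diag_omega, zero_mul, zero_add, map_smul]

/-- Commuting `cayley` past one factor `ω` costs only Euler operators, and these preserve
divisibility by powers of `ω` since `ω` is an eigenvector. -/
theorem omega_pow_dvd_cayley {n : ℕ} {T : MvPolynomial (Fin 2 ⊕ Fin 2) ℂ}
    (h : omega ^ (n + 1) ∣ T) : omega ^ n ∣ cayley T := by
  induction n generalizing T with
  | zero => simp
  | succ n ih =>
    obtain ⟨G, rfl⟩ := h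
    have h1 : ∀ D : Derivation ℂ (MvPolynomial (Fin 2 ⊕ Fin 2) ℂ)
        (MvPolynomial (Fin 2 ⊕ Fin 2) ℂ), D omega = omega →
        omega ^ (n + 1) ∣ D (omega ^ (n + 1) * G) := by
      intro D hD
      rw [Derivation.leibniz, Derivation.leibniz_pow, hD]
      refine dvd_add (Dvd.intro _ rfl) ⟨(n + 1 : ℕ) • G, ?_⟩
      simp only [smul_eq_mul, nsmul_eq_mul, Nat.add_sub_cancel]
      ring
    rw [pow_succ' omega (n + 1), mul_assoc, cayley_omega_mul]
    refine dvd_add (dvd_add (dvd_add ?_ (h1 _ eulerX_omega)) (h1 _ eulerY_omega)) ?_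
    · rw [pow_succ' omega n]
      refine mul_dvd_mul_left _ (ih ?_)
      rw [← pow_succ']
      exact Dvd.intro _ rfl
    · exact (Dvd.intro _ rfl : omega ^ (n + 1) ∣ omega ^ (n + 1) * G).mul_left _

theorem diag_cayley_pow_eq_zero {n r : ℕ} {T : MvPolynomial (Fin 2 ⊕ Fin 2) ℂ}
    (h : omega ^ n ∣ T) (hr : r < n) : diag ((cayley ^ r) T) = 0 := by
  induction r generalizing n T with
  | zero =>
    obtain ⟨G, rfl⟩ := (dvd_pow_self omega (by omega : n ≠ 0)).trans h
    simp [diag_omega]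
  | succ r ih =>
    obtain ⟨n, rfl⟩ : ∃ n', n = n' + 1 := ⟨n - 1, by omega⟩
    rw [pow_succ, Module.End.mul_apply]
    exact ih (omega_pow_dvd_cayley h) (by omega)

theorem coeff_X_mul_pderiv {σ R : Type*} [CommSemiring R] (i : σ) (T : MvPolynomial σ R)
    (k : σ →₀ ℕ) : coeff k (X i * pderiv i T) = k i * coeff k T := by
  classical
  induction T using MvPolynomial.induction_on' with
  | monomial m r =>
    rw [X_mul_pderiv_monomial, coeff_smul, coeff_monomial]
    split_ifs with h
    · rw [h, nsmul_eq_mul]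
    · simp
  | add p q hp hq => rw [map_add, mul_add, coeff_add, coeff_add, hp, hq, mul_add]

theorem Bihom.right_eq {a b : ℂ} {T : MvPolynomial (Fin 2 ⊕ Fin 2) ℂ} (h : Bihom a b T)
    {k : Fin 2 ⊕ Fin 2 →₀ ℕ} (hk : k ∈ T.support) :
    ((k (Sum.inr 0) + k (Sum.inr 1) : ℕ) : ℂ) = b := by
  have h1 := congrArg (coeff k) h.right
  rw [eulerY_apply, coeff_add, coeff_X_mul_pderiv, coeff_X_mul_pderiv, coeff_smul, smul_eq_mul,
    ← add_mul] at h1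
  exact_mod_cast mul_right_cancel₀ (mem_support_iff.1 hk) h1

theorem Bihom.left_eq {a b : ℂ} {T : MvPolynomial (Fin 2 ⊕ Fin 2) ℂ} (h : Bihom a b T)
    {k : Fin 2 ⊕ Fin 2 →₀ ℕ} (hk : k ∈ T.support) :
    ((k (Sum.inl 0) + k (Sum.inl 1) : ℕ) : ℂ) = a := by
  have h1 := congrArg (coeff k) h.left
  rw [eulerX_apply, coeff_add, coeff_X_mul_pderiv, coeff_X_mul_pderiv, coeff_smul, smul_eq_mul,
    ← add_mul] at h1
  exact_mod_cast mul_right_cancel₀ (mem_support_iff.1 hk) h1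

/-- Bidegrees are complex numbers, so division by `ω` can formally produce degree `-1`; no exponent
realizes it. -/
theorem Bihom.eq_zero_of_neg {a b : ℂ} {T : MvPolynomial (Fin 2 ⊕ Fin 2) ℂ} (h : Bihom a b T)
    (hab : a = -1 ∨ b = -1) : T = 0 := by
  by_contra hT
  obtain ⟨k, hk⟩ := T.support_nonempty.2 hT
  rcases hab with rfl | rfl
  · have h1 := h.left_eq hk
    rw [eq_neg_iff_add_eq_zero] at h1
    exact absurd h1 (Nat.cast_add_one_ne_zero _)
  · have h1 := h.right_eq hk
    rw [eq_neg_iff_add_eq_zero] at h1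
    exact absurd h1 (Nat.cast_add_one_ne_zero _)

theorem Bihom.aeval_mul {A : Type*} [CommRing A] [Algebra ℂ A] {a : ℂ} {b : ℕ}
    {T : MvPolynomial (Fin 2 ⊕ Fin 2) ℂ} (h : Bihom a b T) (u v : Fin 2 → A) (s : A) :
    aeval (Sum.elim u fun i => s * v i) T = s ^ b * aeval (Sum.elim u v) T := by
  rw [aeval_def, aeval_def, eval₂_eq', eval₂_eq', Finset.mul_sum]
  refine Finset.sum_congr rfl fun k hk => ?_
  have h1 : k (Sum.inr 0) + k (Sum.inr 1) = b := by exact_mod_cast h.right_eq hk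
  simp only [Fintype.prod_sum_type, Fin.prod_univ_two, Sum.elim_inl, Sum.elim_inr, ← h1]
  ring

theorem not_X_dvd_omega : ¬ (X (Sum.inl 0) : MvPolynomial (Fin 2 ⊕ Fin 2) ℂ) ∣ omega := by
  rintro ⟨G, hG⟩
  have h1 := congrArg (eval (Sum.elim ![0, 1] ![1, 0])) hG
  simp [omega] at h1

/-- Modulo `ω` one has `x₀ y ≡ y₀ x`, hence `x₀^b T(x,y) = T(x, x₀ y) ≡ T(x, y₀ x) = y₀^b T(x,x) =
0`. Since the prime `x₀` does not divide `ω`, the power `x₀^b` can be removed. -/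
theorem Bihom.omega_dvd {a : ℂ} {b : ℕ} {T : MvPolynomial (Fin 2 ⊕ Fin 2) ℂ} (h : Bihom a b T)
    (hT : diag T = 0) : omega ∣ T := by
  set u : Fin 2 → MvPolynomial (Fin 2 ⊕ Fin 2) ℂ := fun i => X (Sum.inl i) with hu
  set v : Fin 2 → MvPolynomial (Fin 2 ⊕ Fin 2) ℂ := fun i => X (Sum.inr i) with hv
  have h1 : aeval (Sum.elim u v) T = T := by
    have : (Sum.elim u v : Fin 2 ⊕ Fin 2 → MvPolynomial (Fin 2 ⊕ Fin 2) ℂ) = X := by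
      ext1 i; rcases i with i | i <;> rfl
    rw [this, aeval_X_left_apply]
  have h2 : aeval (Sum.elim u u) T = 0 := by
    have : (aeval (Sum.elim u u) : MvPolynomial (Fin 2 ⊕ Fin 2) ℂ →ₐ[ℂ] _) =
        (rename Sum.inl).comp diag := by
      refine algHom_ext fun i => ?_
      rcases i with i | i <;> simp [diag, hu]
    rw [this, AlgHom.comp_apply, hT, map_zero]
  have h3 : omega ∣ aeval (Sum.elim u fun i => u 0 * v i) T -
      aeval (Sum.elim u fun i => v 0 * u i) T := by
    rw [← Ideal.mem_span_singleton, ← Ideal.Quotient.eq]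
    have : (Ideal.Quotient.mkₐ ℂ (Ideal.span {omega})).comp
        (aeval (Sum.elim u fun i => u 0 * v i)) =
        (Ideal.Quotient.mkₐ ℂ (Ideal.span {omega})).comp
        (aeval (Sum.elim u fun i => v 0 * u i)) := by
      refine algHom_ext fun i => ?_
      simp only [AlgHom.comp_apply, aeval_X, Ideal.Quotient.mkₐ_eq_mk]
      rcases i with i | i
      · rfl
      · rw [Ideal.Quotient.eq, Ideal.mem_span_singleton]
        fin_cases i
        · exact ⟨0, by simp [hu, hv]; ring⟩
        · exact ⟨1, by simp [hu, hv, omega]; ring⟩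
    exact DFunLike.congr_fun this T
  rw [h.aeval_mul, h.aeval_mul, h1, h2, mul_zero, sub_zero] at h3
  obtain ⟨Q, hQ⟩ := h3
  obtain ⟨Q', rfl⟩ := (X_prime (R := ℂ) (i := Sum.inl (0 : Fin 2))).pow_dvd_of_dvd_mul_left b not_X_dvd_omega
    (Dvd.intro _ hQ)
  refine ⟨Q', mul_left_cancel₀ (pow_ne_zero b (X_ne_zero (R := ℂ) (Sum.inl (0 : Fin 2)))) ?_⟩
  rw [hQ]
  ring

/-- A bihomogeneous polynomial is divisible by `ω^n` if the restrictions to the diagonal of its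
first `n` images under the powers of Cayley's operator vanish. -/
theorem Bihom.omega_pow_dvd {n a b : ℕ} {T : MvPolynomial (Fin 2 ⊕ Fin 2) ℂ} (h : Bihom a b T)
    (hn : n ≤ b + 2) (hT : ∀ r < n, diag ((_root_.BinaryForms.cayley ^ r) T) = 0) :
    omega ^ n ∣ T ∧ (b < n → T = 0) := by
  induction n generalizing a b T with
  | zero => simp
  | succ n ih =>
    obtain ⟨G, rfl⟩ := h.omega_dvd (by simpa using hT 0 (Nat.succ_pos n))
    have hG := h.of_omega_mul
    -- If a degree of `T` is already 0, the quotient `G` has degree `-1` and vanishes. This is what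
    -- forces `T = 0` when `n` exceeds `b`.
    by_cases h0 : a = 0 ∨ b = 0
    · have : G = 0 := hG.eq_zero_of_neg (by rcases h0 with rfl | rfl <;> simp)
      simp [this]
    · push Not at h0
      obtain ⟨a, rfl⟩ := Nat.exists_eq_succ_of_ne_zero h0.1
      obtain ⟨b, rfl⟩ := Nat.exists_eq_succ_of_ne_zero h0.2
      replace hG : Bihom a b G := hG.congr (by push_cast; ring) (by push_cast; ring)
      obtain ⟨h1, h2⟩ := ih hG (by omega) fun r hr => by
        have h3 := hT (r + 1) (by omega)
        rw [diag_cayley_pow_omega_mul r hG] at h3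
        refine (smul_eq_zero.1 h3).resolve_left (mul_ne_zero (Nat.cast_add_one_ne_zero r) ?_)
        -- The factor `a + b + 2 - r` is nonzero because `r < n ≤ b + 2`; this is the role of the
        -- bound on `n`.
        rw [sub_ne_zero]
        norm_cast
        omega
      refine ⟨?_, fun hb => ?_⟩
      · rw [pow_succ']
        exact mul_dvd_mul_left _ h1
      · rw [h2 (by omega), mul_zero]

end

/-! ### Transvectants and polars through Cayley's operator. -/

section

theorem pderiv_inl_inX (i : Fin 2) (E : MvPolynomial (Fin 2) ℂ) :
    pderiv (Sum.inl i) (inX E) = inX (pderiv i E) :=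
  pderiv_rename Sum.inl_injective i E

theorem pderiv_inr_inY (i : Fin 2) (E : MvPolynomial (Fin 2) ℂ) :
    pderiv (Sum.inr i) (inY E) = inY (pderiv i E) :=
  pderiv_rename Sum.inr_injective i E

theorem pderiv_inr_inX (i : Fin 2) (E : MvPolynomial (Fin 2) ℂ) :
    pderiv (Sum.inr i) (inX E) = 0 := by
  classical
  refine pderiv_eq_zero_of_notMem_vars fun h => ?_
  obtain ⟨j, -, hj⟩ := Finset.mem_image.1 (vars_rename _ _ h)
  exact absurd hj (by simp)

theorem pderiv_inl_inY (i : Fin 2) (E : MvPolynomial (Fin 2) ℂ) :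
    pderiv (Sum.inl i) (inY E) = 0 := by
  classical
  refine pderiv_eq_zero_of_notMem_vars fun h => ?_
  obtain ⟨j, -, hj⟩ := Finset.mem_image.1 (vars_rename _ _ h)
  exact absurd hj (by simp)

theorem diag_inX (E : MvPolynomial (Fin 2) ℂ) : diag (inX E) = E := by
  rw [diag, inX, aeval_rename]
  exact aeval_X_left_apply E

theorem diag_inY (E : MvPolynomial (Fin 2) ℂ) : diag (inY E) = E := by
  rw [diag, inY, aeval_rename]
  exact aeval_X_left_apply E

theorem bihom_inX {e : ℕ} {E : MvPolynomial (Fin 2) ℂ} (hE : E ∈ S e) : Bihom e 0 (inX E) := by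
  constructor
  · have h := euler_partialD hE 0 0
    simp only [← pderiv_zero_partialD, ← pderiv_one_partialD, partialD_zero_zero] at h
    have h1 := congrArg inX h
    simp only [inX, map_add, map_mul, rename_X, rename_C] at h1
    rw [eulerX_apply, pderiv_inl_inX, pderiv_inl_inX, smul_eq_C_mul]
    simpa [inX] using h1
  · simp [eulerY_apply, pderiv_inr_inX]

theorem bihom_inY {e : ℕ} {E : MvPolynomial (Fin 2) ℂ} (hE : E ∈ S e) : Bihom 0 e (inY E) := by
  constructor
  · simp [eulerX_apply, pderiv_inl_inY]
  · have h := euler_partialD hE 0 0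
    simp only [← pderiv_zero_partialD, ← pderiv_one_partialD, partialD_zero_zero] at h
    have h1 := congrArg inY h
    simp only [inY, map_add, map_mul, rename_X, rename_C] at h1
    rw [eulerY_apply, pderiv_inr_inY, pderiv_inr_inY, smul_eq_C_mul]
    simpa [inY] using h1

/-- The transvectant without its normalizing factor. -/
def rawTransvectant (r : ℕ) (E F : MvPolynomial (Fin 2) ℂ) : MvPolynomial (Fin 2) ℂ :=
  ∑ i ∈ Finset.range (r + 1),
    ((-1 : ℂ) ^ i * (r.choose i : ℂ)) • (partialD (r - i) i E * partialD i (r - i) F)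

theorem transvectant_eq (e f r : ℕ) (E F : MvPolynomial (Fin 2) ℂ) :
    transvectant e f r E F = ((((e - r).factorial : ℂ) * ((f - r).factorial : ℂ)) /
      ((e.factorial : ℂ) * (f.factorial : ℂ))) • rawTransvectant r E F := rfl

theorem transvectant_factor_ne_zero (e f r : ℕ) :
    (((e - r).factorial : ℂ) * ((f - r).factorial : ℂ)) /
      ((e.factorial : ℂ) * (f.factorial : ℂ)) ≠ 0 := by
  simp [Nat.factorial_ne_zero]

theorem rawTransvectant_swap (r : ℕ) (E F : MvPolynomial (Fin 2) ℂ) :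
    rawTransvectant r F E = (-1 : ℂ) ^ r • rawTransvectant r E F := by
  rw [rawTransvectant, rawTransvectant, ← Finset.sum_range_reflect, Finset.smul_sum]
  refine Finset.sum_congr rfl fun i hi => ?_
  have hi' : i ≤ r := by simpa [Nat.lt_succ_iff] using hi
  rw [show r + 1 - 1 - i = r - i by omega, Nat.sub_sub_self hi', Nat.choose_symm hi', smul_smul,
    mul_comm (partialD i (r - i) F)]
  congr 1
  obtain ⟨j, rfl⟩ := Nat.exists_eq_add_of_le hi'
  rw [Nat.add_sub_cancel_left, pow_add, mul_comm ((-1 : ℂ) ^ i), ← mul_assoc,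
    mul_assoc _ _ ((-1 : ℂ) ^ i), ← mul_pow]
  norm_num

/-- `cayley` is a difference of two commuting operators, so its powers expand by the binomial
theorem. -/
theorem cayley_pow_inX_mul_inY (r : ℕ) (E F : MvPolynomial (Fin 2) ℂ) :
    (cayley ^ r) (inX E * inY F) = ∑ i ∈ Finset.range (r + 1),
      ((-1 : ℂ) ^ i * (r.choose i : ℂ)) •
        (inX (partialD (r - i) i E) * inY (partialD i (r - i) F)) := by
  set A : Module.End ℂ (MvPolynomial (Fin 2 ⊕ Fin 2) ℂ) :=
    (pderiv (Sum.inl 0)).toLinearMap ∘ₗ (pderiv (Sum.inr 1)).toLinearMap with hA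
  set B : Module.End ℂ (MvPolynomial (Fin 2 ⊕ Fin 2) ℂ) :=
    (pderiv (Sum.inl 1)).toLinearMap ∘ₗ (pderiv (Sum.inr 0)).toLinearMap with hB
  have hAB : Commute A B := by
    refine LinearMap.ext fun p => ?_
    simp only [hA, hB, Module.End.mul_apply, LinearMap.comp_apply, Derivation.coeFn_coe,
      pderiv_comm (Sum.inr _) (Sum.inl _)]
    rw [pderiv_comm (Sum.inl 0) (Sum.inl 1), pderiv_comm (Sum.inr 1) (Sum.inr 0)]
  have hA1 : ∀ k l k' l', A (inX (partialD k l E) * inY (partialD k' l' F)) =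
      inX (partialD (k + 1) l E) * inY (partialD k' (l' + 1) F) := by
    intro k l k' l'
    simp [hA, pderiv_inl_inX, pderiv_inr_inX, pderiv_inr_inY, pderiv_inl_inY,
      pderiv_zero_partialD, pderiv_one_partialD, mul_comm]
  have hB1 : ∀ k l k' l', B (inX (partialD k l E) * inY (partialD k' l' F)) =
      inX (partialD k (l + 1) E) * inY (partialD (k' + 1) l' F) := by
    intro k l k' l'
    simp [hB, pderiv_inl_inX, pderiv_inr_inX, pderiv_inr_inY, pderiv_inl_inY,
      pderiv_zero_partialD, pderiv_one_partialD, mul_comm]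
  have hBn : ∀ n, (B ^ n) (inX E * inY F) = inX (partialD 0 n E) * inY (partialD n 0 F) := by
    intro n
    induction n with
    | zero => simp [partialD_zero_zero]
    | succ n ih => rw [pow_succ', Module.End.mul_apply, ih, hB1]
  have hABn : ∀ m n, (A ^ m * B ^ n) (inX E * inY F) =
      inX (partialD m n E) * inY (partialD n m F) := by
    intro m n
    induction m with
    | zero => rw [pow_zero, one_mul, hBn]
    | succ m ih => rw [pow_succ', mul_assoc, Module.End.mul_apply, ih, hA1]
  have hc : cayley = -B + A := by rw [neg_add_eq_sub]; rfl
  rw [hc, (hAB.symm.neg_left).add_pow, LinearMap.sum_apply]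
  refine Finset.sum_congr rfl fun i _ => ?_
  have h1 : (-B) ^ i * A ^ (r - i) * (r.choose i : Module.End ℂ _) =
      ((-1 : ℂ) ^ i * (r.choose i : ℂ)) • (A ^ (r - i) * B ^ i) := by
    rw [← neg_one_smul ℂ B, smul_pow, smul_mul_assoc, (hAB.symm.pow_pow i (r - i)).eq,
      ← nsmul_eq_mul', smul_comm, ← Nat.cast_smul_eq_nsmul ℂ, smul_smul, mul_comm]
  rw [h1, LinearMap.smul_apply, hABn]

theorem diag_cayley_pow_inX_mul_inY (r : ℕ) (E F : MvPolynomial (Fin 2) ℂ) :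
    diag ((cayley ^ r) (inX E * inY F)) = rawTransvectant r E F := by
  simp only [cayley_pow_inX_mul_inY, map_sum, map_smul, map_mul, diag_inX, diag_inY,
    rawTransvectant]

theorem eulerX_polarOp (T : MvPolynomial (Fin 2 ⊕ Fin 2) ℂ) :
    eulerX (polarOp T) = polarOp (eulerX T) - polarOp T := by
  simp only [polarOp, Fin.sum_univ_two, eulerX_apply, pderiv_mul, map_add, pderiv_X,
    Pi.single_apply, Sum.inl.injEq, reduceCtorEq, if_true, if_false, zero_ne_one, one_ne_zero]
  linear_combination (X (Sum.inl 0) * X (Sum.inr 1) - X (Sum.inl 1) * X (Sum.inr 0)) *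
    pderiv_comm (Sum.inl 0) (Sum.inl 1) T

theorem eulerY_polarOp (T : MvPolynomial (Fin 2 ⊕ Fin 2) ℂ) :
    eulerY (polarOp T) = polarOp (eulerY T) + polarOp T := by
  simp only [polarOp, Fin.sum_univ_two, eulerY_apply, pderiv_mul, map_add, pderiv_X,
    Pi.single_apply, Sum.inr.injEq, reduceCtorEq, if_true, if_false, zero_ne_one, one_ne_zero,
    pderiv_comm (Sum.inr _) (Sum.inl _)]
  ring

/-- `polarOp` infinitesimally adds a multiple of `y` to `x`, and `cayley` is the determinant of the
two gradients, which such a unipotent change leaves invariant. -/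
theorem cayley_polarOp (T : MvPolynomial (Fin 2 ⊕ Fin 2) ℂ) :
    cayley (polarOp T) = polarOp (cayley T) := by
  simp only [polarOp, Fin.sum_univ_two, cayley_apply, pderiv_mul, map_add, map_sub, pderiv_X,
    Pi.single_apply, Sum.inr.injEq, reduceCtorEq, if_true, if_false, zero_ne_one, one_ne_zero,
    map_zero, pderiv_one, pderiv_comm (Sum.inr _) (Sum.inl _)]
  linear_combination pderiv_comm (Sum.inl 0) (Sum.inl 1) T +
    X (Sum.inr 0) * pderiv_comm (Sum.inl 0) (Sum.inl 1) (pderiv (Sum.inr 0) T) +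
    X (Sum.inr 1) * pderiv_comm (Sum.inl 0) (Sum.inl 1) (pderiv (Sum.inr 1) T)

theorem polarOp_smul (c : ℂ) (T : MvPolynomial (Fin 2 ⊕ Fin 2) ℂ) :
    polarOp (c • T) = c • polarOp T := by
  simp only [polarOp, Derivation.map_smul, mul_smul_comm, Finset.smul_sum]

theorem Bihom.polarOp {a b : ℂ} {T : MvPolynomial (Fin 2 ⊕ Fin 2) ℂ} (h : Bihom a b T) :
    Bihom (a - 1) (b + 1) (polarOp T) :=
  ⟨by rw [eulerX_polarOp, h.left, polarOp_smul, sub_smul, one_smul],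
    by rw [eulerY_polarOp, h.right, polarOp_smul, add_smul, one_smul]⟩

/-- On `y = x` the field `y·∂ₓ` becomes `x·∂ₓ`; iteration therefore multiplies by falling
factorials, cancelled in `polar`. -/
theorem diag_polarOp (T : MvPolynomial (Fin 2 ⊕ Fin 2) ℂ) :
    diag (polarOp T) = diag (eulerX T) := by
  simp [polarOp, eulerX_apply, diag]

theorem bihom_polarOp_iterate {e : ℕ} {E : MvPolynomial (Fin 2) ℂ} (hE : E ∈ S e) (m : ℕ) :
    Bihom (e - m) m (polarOp^[m] (inX E)) := by
  induction m with
  | zero => simpa using bihom_inX hE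
  | succ m ih =>
    rw [Function.iterate_succ_apply']
    exact ih.polarOp.congr (by push_cast; ring) (by push_cast; ring)

theorem diag_polarOp_iterate {e m : ℕ} {E : MvPolynomial (Fin 2) ℂ} (hE : E ∈ S e) (hm : m ≤ e) :
    ((e - m).factorial : ℂ) • diag (polarOp^[m] (inX E)) = (e.factorial : ℂ) • E := by
  induction m with
  | zero => simp [diag_inX]
  | succ m ih =>
    rw [← ih (by omega), Function.iterate_succ_apply', diag_polarOp,
      (bihom_polarOp_iterate hE m).left, map_smul, smul_smul]
    congr 1
    obtain ⟨k, rfl⟩ := Nat.exists_eq_add_of_le hm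
    rw [Nat.add_sub_cancel_left, show m + 1 + k - m = k + 1 by omega, Nat.factorial_succ]
    push_cast
    ring

theorem cayley_inX (E : MvPolynomial (Fin 2) ℂ) : cayley (inX E) = 0 := by
  simp [cayley_apply, pderiv_inr_inX]

theorem cayley_polarOp_iterate (E : MvPolynomial (Fin 2) ℂ) (m : ℕ) :
    cayley (polarOp^[m] (inX E)) = 0 := by
  induction m with
  | zero => exact cayley_inX E
  | succ m ih => rw [Function.iterate_succ_apply', cayley_polarOp, ih]; simp [polarOp]

variable {e m : ℕ}

theorem bihom_symPolar (he : e = 2 * m) (E : S e) : Bihom m m (symPolar E) := by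
  subst he
  rw [symPolar, polar, Nat.mul_div_cancel_left m two_pos]
  exact ((bihom_polarOp_iterate E.2 m).smul _).congr (by push_cast; ring) rfl

theorem diag_symPolar (he : e = 2 * m) (E : S e) : diag (symPolar E) = E := by
  subst he
  rw [symPolar, polar, Nat.mul_div_cancel_left m two_pos, map_smul, div_eq_inv_mul, mul_smul,
    diag_polarOp_iterate E.2 (by omega), smul_smul,
    inv_mul_cancel₀ (Nat.cast_ne_zero.2 (Nat.factorial_ne_zero _)), one_smul]

/-- With `bihom_symPolar` and `diag_symPolar`, this makes `symPolar E` the leading term in a Gordan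
series: balanced bidegree, diagonal restriction `E`, no contribution in higher order. -/
theorem cayley_symPolar (E : S e) : cayley (symPolar E) = 0 := by
  rw [symPolar, polar, map_smul, cayley_polarOp_iterate, smul_zero]

end

/-! ### The Gordan series of the Bézoutiant modulo `ω⁴`. -/

section

/-- `G` is an extremal vector for the `sl₂`-triple: `Ω(ωG) = (2b+2)G`, and `4b + 6 = (2b + 4) + (2b
+ 2)`, the first summand coming from the bidegree of `ωG`. -/
theorem omega_smul_pow_two {b : ℂ} {G : MvPolynomial (Fin 2 ⊕ Fin 2) ℂ} (hG : Bihom b b G)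
    (h0 : cayley G = 0) :
    cayley (omega ^ 2 * G) = (4 * b + 6) • (omega * G) ∧
      (cayley ^ 2) (omega ^ 2 * G) = ((4 * b + 6) * (2 * b + 2)) • G := by
  have h1 : cayley (omega * G) = (2 * b + 2) • G := by
    rw [cayley_omega_mul_of_bihom hG, h0, mul_zero, zero_add, ← two_mul]
  have h2 : cayley (omega ^ 2 * G) = (4 * b + 6) • (omega * G) := by
    rw [pow_two, mul_assoc, cayley_omega_mul_of_bihom (bihom_omega.mul hG), h1, mul_smul_comm,
      ← add_smul]
    congr 1
    ring
  refine ⟨h2, ?_⟩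
  rw [pow_two cayley, Module.End.mul_apply, h2, map_smul, h1, smul_smul]

section Bezoutiant

variable {d : ℕ}

theorem bihom_bezoutiant (A B : S d) : Bihom (d - 1) (d - 1) (bezoutiant A B) := by
  refine Bihom.of_omega_mul ?_
  rw [omega_mul_bezoutiant]
  exact (((bihom_inX A.2).mul (bihom_inY B.2)).sub
    ((bihom_inX B.2).mul (bihom_inY A.2))).congr (by simp) (by simp)

/-- Applying `Ω^(r+1)` to `ω R = A(x)B(y) - B(x)A(y)` and restricting to the diagonal: the right
side gives transvectants, the left loses its factor `ω`. -/
theorem diag_cayley_pow_bezoutiant (A B : S d) (r : ℕ) :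
    ((r + 1 : ℂ) * (2 * d - r)) • diag ((cayley ^ r) (bezoutiant A B)) =
      rawTransvectant (r + 1) (A : MvPolynomial (Fin 2) ℂ) B -
        rawTransvectant (r + 1) (B : MvPolynomial (Fin 2) ℂ) A := by
  rw [← diag_cayley_pow_inX_mul_inY, ← diag_cayley_pow_inX_mul_inY, ← map_sub, ← map_sub,
    ← omega_mul_bezoutiant, diag_cayley_pow_omega_mul r (bihom_bezoutiant A B)]
  congr 2
  ring

theorem diag_cayley_pow_bezoutiant_of_even (A B : S d) {r : ℕ} (hr : Even r) :
    ((r + 1 : ℂ) * (2 * d - r)) • diag ((cayley ^ r) (bezoutiant A B)) =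
      (2 : ℂ) • rawTransvectant (r + 1) (A : MvPolynomial (Fin 2) ℂ) B := by
  rw [diag_cayley_pow_bezoutiant, rawTransvectant_swap _ (A : MvPolynomial (Fin 2) ℂ),
    hr.add_one.neg_one_pow, two_smul, neg_one_smul, sub_neg_eq_add]

/-- Transvectants of even index `r + 1` are symmetric, so the two terms cancel. -/
theorem diag_cayley_pow_bezoutiant_of_odd (A B : S d) {r : ℕ} (hr : Odd r) (hrd : r < 2 * d) :
    diag ((cayley ^ r) (bezoutiant A B)) = 0 := by
  have h := diag_cayley_pow_bezoutiant A B r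
  rw [rawTransvectant_swap _ (A : MvPolynomial (Fin 2) ℂ), hr.add_one.neg_one_pow, one_smul,
    sub_self] at h
  refine (smul_eq_zero.1 h).resolve_left (mul_ne_zero (Nat.cast_add_one_ne_zero r) ?_)
  rw [sub_ne_zero]
  norm_cast
  omega

end Bezoutiant

theorem cast_choose_three (k : ℕ) : ((k + 2).choose 3 : ℂ) = (k + 2) * (k + 1) * k / 6 := by
  have h := Nat.descFactorial_eq_factorial_mul_choose (k + 2) 3
  have h2 : (k + 2).descFactorial 3 = (k + 2) * (k + 1) * k := by
    simp [Nat.descFactorial]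
    ring
  rw [h2] at h
  have h3 := congrArg (Nat.cast (R := ℂ)) h
  norm_num [Nat.factorial] at h3
  rw [h3]
  ring

theorem cConst_zero (n : ℕ) : cConst (n + 3) 0 = n + 3 := by
  have h : (n + 3 : ℂ) ≠ 0 := by exact_mod_cast (Nat.succ_ne_zero (n + 2))
  simp only [cConst, mul_zero, zero_add, Nat.choose_one_right, Nat.sub_zero]
  push_cast
  field_simp

/-- The calibration of `c₁` for `d = n + 3`: `(4n+6)(2n+2)` is the effect of `Ω²` on `ω² N^sym`,
`3(2n+4)` is `(r+1)(2d-r)` at `r = 2`, and the square on the right converts the raw third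
transvectant to the normalized one. -/
theorem cConst_one_mul (n : ℕ) : cConst (n + 3) 1 * ((4 * n + 6) * (2 * n + 2)) * (3 * (2 * n + 4)) =
    2 * ((n + 3) * (n + 2) * (n + 1)) ^ 2 := by
  have h1 : (n + 1 : ℂ) ≠ 0 := by exact_mod_cast (Nat.succ_ne_zero n)
  have h2 : (n + 2 : ℂ) ≠ 0 := by exact_mod_cast (Nat.succ_ne_zero (n + 1))
  have h3 : (2 * n + 3 : ℂ) ≠ 0 := by exact_mod_cast (Nat.succ_ne_zero (2 * n + 2))
  rw [cConst, show 2 * 1 + 1 = 3 from rfl, show 2 * (n + 3) - 2 * 1 = (2 * n + 2) + 2 by omega,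
    cast_choose_three, cast_choose_three (2 * n + 2)]
  push_cast
  rw [show (2 * n + 2 + 2 : ℂ) = 2 * (n + 2) by ring, show (2 * n + 2 + 1 : ℂ) = 2 * n + 3 by ring,
    show (2 * n + 2 : ℂ) = 2 * (n + 1) by ring]
  field_simp
  ring

theorem rawTransvectant_one_eq (n : ℕ) (A B : MvPolynomial (Fin 2) ℂ) :
    rawTransvectant 1 A B = ((n + 3 : ℂ) ^ 2) • transvectant (n + 3) (n + 3) 1 A B := by
  have h : (n + 3 : ℂ) ≠ 0 := by exact_mod_cast (Nat.succ_ne_zero (n + 2))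
  have hf : ((n + 2).factorial : ℂ) ≠ 0 := by exact_mod_cast Nat.factorial_ne_zero _
  rw [transvectant_eq, smul_smul, show n + 3 - 1 = n + 2 by omega, Nat.factorial_succ (n + 2)]
  push_cast
  rw [show (n + 2 + 1 : ℂ) = n + 3 by ring]
  field_simp
  simp

theorem rawTransvectant_three_eq (n : ℕ) (A B : MvPolynomial (Fin 2) ℂ) :
    rawTransvectant 3 A B =
      (((n + 3 : ℂ) * (n + 2) * (n + 1)) ^ 2) • transvectant (n + 3) (n + 3) 3 A B := by
  have h1 : (n + 1 : ℂ) ≠ 0 := by exact_mod_cast (Nat.succ_ne_zero n)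
  have h2 : (n + 2 : ℂ) ≠ 0 := by exact_mod_cast (Nat.succ_ne_zero (n + 1))
  have h3 : (n + 3 : ℂ) ≠ 0 := by exact_mod_cast (Nat.succ_ne_zero (n + 2))
  have hf : (n.factorial : ℂ) ≠ 0 := by exact_mod_cast Nat.factorial_ne_zero _
  rw [transvectant_eq, smul_smul, Nat.add_sub_cancel, Nat.factorial_succ (n + 2),
    Nat.factorial_succ (n + 1), Nat.factorial_succ n]
  push_cast
  rw [show (n + 2 + 1 : ℂ) = n + 3 by ring, show (n + 1 + 1 : ℂ) = n + 2 by ring]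
  field_simp
  simp

/-- The beginning of the Gordan series of the Bézoutiant. -/
theorem omega_pow_four_dvd_iff {d : ℕ} (hd : 3 ≤ d) (A B : S d) (M : S (2 * d - 2))
    (N : S (2 * d - 6)) :
    omega ^ 4 ∣ bezoutiant A B -
        (cConst d 0 • symPolar M + cConst d 1 • (omega ^ 2 * symPolar N)) ↔
      (M : MvPolynomial (Fin 2) ℂ) = transvectant d d 1 A B ∧
        (N : MvPolynomial (Fin 2) ℂ) = transvectant d d 3 A B := by
  -- With `d = n + 3` the truncated subtractions in the orders become exact.
  obtain ⟨n, rfl⟩ : ∃ n, d = n + 3 := ⟨d - 3, by omega⟩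
  set T := bezoutiant A B -
    (cConst (n + 3) 0 • symPolar M + cConst (n + 3) 1 • (omega ^ 2 * symPolar N)) with hT
  have hM : Bihom ((n + 2 : ℕ) : ℂ) ((n + 2 : ℕ) : ℂ) (symPolar M) := bihom_symPolar (by omega) M
  have hN : Bihom (n : ℂ) n (symPolar N) := bihom_symPolar (by omega) N
  have hω := omega_smul_pow_two hN (cayley_symPolar N)
  have hR : Bihom ((n + 2 : ℕ) : ℂ) ((n + 2 : ℕ) : ℂ) (bezoutiant A B) :=
    (bihom_bezoutiant A B).congr (by push_cast; ring) (by push_cast; ring)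
  have hωN : Bihom ((n + 2 : ℕ) : ℂ) ((n + 2 : ℕ) : ℂ) (omega ^ 2 * symPolar N) := by
    rw [pow_two, mul_assoc]
    exact (bihom_omega.mul (bihom_omega.mul hN)).congr (by push_cast; ring) (by push_cast; ring)
  have hTb : Bihom ((n + 2 : ℕ) : ℂ) ((n + 2 : ℕ) : ℂ) T := hR.sub ((hM.smul _).add (hωN.smul _))
  have n3 : (n + 3 : ℂ) ≠ 0 := by exact_mod_cast (Nat.succ_ne_zero (n + 2))
  have e0 : diag T = (n + 3 : ℂ) • (transvectant (n + 3) (n + 3) 1 A B - M) := by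
    have h1 := diag_cayley_pow_bezoutiant_of_even A B (r := 0) Even.zero
    rw [pow_zero, Module.End.one_apply, zero_add, rawTransvectant_one_eq n, smul_smul] at h1
    have h2 : diag (bezoutiant A B) = (n + 3 : ℂ) • transvectant (n + 3) (n + 3) 1 A B := by
      refine smul_right_injective _ (mul_ne_zero two_ne_zero n3) ?_
      simp only [smul_smul]
      convert h1 using 2
      · push_cast; ring
      · ring
    rw [hT, map_sub, map_add, map_smul, map_smul, map_mul, map_pow, diag_omega, h2, cConst_zero,
      diag_symPolar (m := n + 2) (by omega) M, smul_sub]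
    simp
  have e1 : diag ((cayley ^ 1) T) = 0 := by
    rw [hT, map_sub, map_add, map_smul, map_smul, map_sub, map_add,
      diag_cayley_pow_bezoutiant_of_odd A B odd_one (by omega), pow_one, cayley_symPolar, hω.1]
    simp [diag_omega]
  have hc2 : (cayley ^ 2) (symPolar M) = 0 := by
    rw [pow_two, Module.End.mul_apply, cayley_symPolar, map_zero]
  have e2 : (3 * (2 * n + 4) : ℂ) • diag ((cayley ^ 2) T) =
      (2 * ((n + 3) * (n + 2) * (n + 1)) ^ 2 : ℂ) • (transvectant (n + 3) (n + 3) 3 A B - N) := by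
    have h1 := diag_cayley_pow_bezoutiant_of_even A B (r := 2) even_two
    rw [rawTransvectant_three_eq n, smul_smul] at h1
    rw [hT, map_sub, map_add, map_smul, map_smul, map_sub, map_add, hω.2, hc2, smul_zero,
      map_zero, zero_add, map_smul, map_smul, diag_symPolar (m := n) (by omega) N, smul_smul, smul_sub,
      smul_smul, smul_sub, ← h1, ← cConst_one_mul]
    congr 2
    · push_cast; ring
    · ring
  have e3 : diag ((cayley ^ 3) T) = 0 := by
    have h1 : (cayley ^ 3) (symPolar M) = 0 := by
      rw [pow_succ', Module.End.mul_apply, hc2, map_zero]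
    have h2 : (cayley ^ 3) (omega ^ 2 * symPolar N) = 0 := by
      rw [pow_succ', Module.End.mul_apply, hω.2, map_smul, cayley_symPolar, smul_zero]
    rw [hT, map_sub, map_add, map_smul, map_smul, map_sub, h1, h2,
      diag_cayley_pow_bezoutiant_of_odd A B (by decide) (by omega)]
    simp
  have n1 : (n + 1 : ℂ) ≠ 0 := by exact_mod_cast (Nat.succ_ne_zero n)
  have n2 : (n + 2 : ℂ) ≠ 0 := by exact_mod_cast (Nat.succ_ne_zero (n + 1))
  have n4 : (3 * (2 * n + 4) : ℂ) ≠ 0 := by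
    exact_mod_cast (by omega : 3 * (2 * n + 4) ≠ 0)
  constructor
  · intro h
    constructor
    · have h1 := diag_cayley_pow_eq_zero (r := 0) h (by norm_num)
      rw [pow_zero, Module.End.one_apply, e0] at h1
      exact (sub_eq_zero.1 ((smul_eq_zero.1 h1).resolve_left n3)).symm
    · have h1 := diag_cayley_pow_eq_zero (r := 2) h (by norm_num)
      rw [h1, smul_zero] at e2
      refine (sub_eq_zero.1 ((smul_eq_zero.1 e2.symm).resolve_left ?_)).symm
      exact mul_ne_zero two_ne_zero (pow_ne_zero 2 (mul_ne_zero (mul_ne_zero n3 n2) n1))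
  · rintro ⟨h1, h2⟩
    -- The required bound `4 ≤ (d - 1) + 2` is exactly `d ≥ 3`.
    refine (hTb.omega_pow_dvd (n := 4) (by omega) fun r hr => ?_).1
    interval_cases r
    · rw [pow_zero, Module.End.one_apply, e0, h1, sub_self, smul_zero]
    · exact e1
    · rw [h2, sub_self, smul_zero] at e2
      exact (smul_eq_zero.1 e2).resolve_left n4
    · exact e3

end

/-! ### The two transvectant identities. -/

theorem rawTransvectant_one (A B : MvPolynomial (Fin 2) ℂ) : rawTransvectant 1 A B =
    partialD 1 0 A * partialD 0 1 B - partialD 0 1 A * partialD 1 0 B := by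
  simp [rawTransvectant, Finset.sum_range_succ, sub_eq_add_neg]

theorem rawTransvectant_two (A B : MvPolynomial (Fin 2) ℂ) : rawTransvectant 2 A B =
    partialD 2 0 A * partialD 0 2 B - 2 * (partialD 1 1 A * partialD 1 1 B) +
      partialD 0 2 A * partialD 2 0 B := by
  simp [rawTransvectant, Finset.sum_range_succ, smul_eq_C_mul, sub_eq_add_neg]

theorem rawTransvectant_three (A B : MvPolynomial (Fin 2) ℂ) : rawTransvectant 3 A B =
    partialD 3 0 A * partialD 0 3 B - 3 * (partialD 2 1 A * partialD 1 2 B) +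
      3 * (partialD 1 2 A * partialD 2 1 B) - partialD 0 3 A * partialD 3 0 B := by
  simp [rawTransvectant, Finset.sum_range_succ, smul_eq_C_mul, sub_eq_add_neg]
  ring

/-- Euler's formula solved for a derivative of degree `t + 1`. That factor is carried in the
constants, so iterating down from the top polars strips falling factorials one factor at a time. -/
theorem partialD_eq_of_lt {m : ℕ} {F : MvPolynomial (Fin 2) ℂ} (hF : F ∈ S m) {k l t : ℕ}
    (ht : m = k + l + (t + 1)) {a b : MvPolynomial (Fin 2) ℂ} {c : ℂ}
    (ha : partialD (k + 1) l F = C ((t + 1) * c) * a)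
    (hb : partialD k (l + 1) F = C ((t + 1) * c) * b) :
    partialD k l F = C c * (X 0 * a + X 1 * b) := by
  have h := euler_partialD hF k l
  rw [ha, hb, show m - (k + l) = t + 1 by omega] at h
  have h0 : (C ((t + 1 : ℕ) : ℂ) : MvPolynomial (Fin 2) ℂ) ≠ 0 := by
    rw [Ne, C_eq_zero]
    exact Nat.cast_ne_zero.2 (Nat.succ_ne_zero t)
  refine mul_left_cancel₀ h0 ?_
  rw [← h]
  push_cast
  simp only [C_mul, C_add]
  ring

/-- The normalized second polars of a form. -/
theorem exists_second_polars {m : ℕ} {F : MvPolynomial (Fin 2) ℂ} (hF : F ∈ S (m + 2)) :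
    ∃ p q r, partialD 2 0 F = C ((m + 2) * (m + 1) : ℂ) * p ∧
      partialD 1 1 F = C ((m + 2) * (m + 1) : ℂ) * q ∧
      partialD 0 2 F = C ((m + 2) * (m + 1) : ℂ) * r ∧
      partialD 1 0 F = C (m + 2 : ℂ) * (X 0 * p + X 1 * q) ∧
      partialD 0 1 F = C (m + 2 : ℂ) * (X 0 * q + X 1 * r) ∧
      F = X 0 * (X 0 * p + X 1 * q) + X 1 * (X 0 * q + X 1 * r) := by
  have h1 : (m + 1 : ℂ) ≠ 0 := by exact_mod_cast (Nat.succ_ne_zero m)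
  have h2 : (m + 2 : ℂ) ≠ 0 := by exact_mod_cast (Nat.succ_ne_zero (m + 1))
  have hc : ∀ G : MvPolynomial (Fin 2) ℂ,
      G = C ((m + 2) * (m + 1) : ℂ) * (C ((m + 2) * (m + 1) : ℂ)⁻¹ * G) := by
    intro G
    rw [← mul_assoc, ← C_mul, mul_inv_cancel₀ (mul_ne_zero h2 h1), C_1, one_mul]
  have e20 := hc (partialD 2 0 F)
  have e11 := hc (partialD 1 1 F)
  have e02 := hc (partialD 0 2 F)
  have e10 := partialD_eq_of_lt hF (k := 1) (l := 0) (t := m) (by omega) (c := m + 2)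
    (by rw [mul_comm (m + 1 : ℂ)]; exact e20) (by rw [mul_comm (m + 1 : ℂ)]; exact e11)
  have e01 := partialD_eq_of_lt hF (k := 0) (l := 1) (t := m) (by omega) (c := m + 2)
    (by rw [mul_comm (m + 1 : ℂ)]; exact e11) (by rw [mul_comm (m + 1 : ℂ)]; exact e02)
  have hm : (m + 2 : ℂ) = ((m + 1 : ℕ) + 1) * 1 := by push_cast; ring
  have e00 := partialD_eq_of_lt hF (k := 0) (l := 0) (t := m + 1) (by omega) (c := 1)
    (by rw [← hm]; exact e10) (by rw [← hm]; exact e01)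
  rw [partialD_zero_zero, C_1, one_mul] at e00
  exact ⟨_, _, _, e20, e11, e02, e10, e01, e00⟩

/-- The normalized third polars of a form. -/
theorem exists_third_polars {n : ℕ} {F : MvPolynomial (Fin 2) ℂ} (hF : F ∈ S (n + 3)) :
    ∃ a b c e, partialD 3 0 F = C ((n + 1) * ((n + 2) * (n + 3)) : ℂ) * a ∧
      partialD 2 1 F = C ((n + 1) * ((n + 2) * (n + 3)) : ℂ) * b ∧
      partialD 1 2 F = C ((n + 1) * ((n + 2) * (n + 3)) : ℂ) * c ∧
      partialD 0 3 F = C ((n + 1) * ((n + 2) * (n + 3)) : ℂ) * e ∧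
      partialD 2 0 F = C ((n + 2) * (n + 3) : ℂ) * (X 0 * a + X 1 * b) ∧
      partialD 1 1 F = C ((n + 2) * (n + 3) : ℂ) * (X 0 * b + X 1 * c) ∧
      partialD 0 2 F = C ((n + 2) * (n + 3) : ℂ) * (X 0 * c + X 1 * e) ∧
      partialD 1 0 F = C (n + 3 : ℂ) *
        (X 0 * (X 0 * a + X 1 * b) + X 1 * (X 0 * b + X 1 * c)) ∧
      partialD 0 1 F = C (n + 3 : ℂ) *
        (X 0 * (X 0 * b + X 1 * c) + X 1 * (X 0 * c + X 1 * e)) ∧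
      F = X 0 * (X 0 * (X 0 * a + X 1 * b) + X 1 * (X 0 * b + X 1 * c)) +
        X 1 * (X 0 * (X 0 * b + X 1 * c) + X 1 * (X 0 * c + X 1 * e)) := by
  have h1 : (n + 1 : ℂ) ≠ 0 := by exact_mod_cast (Nat.succ_ne_zero n)
  have h2 : (n + 2 : ℂ) ≠ 0 := by exact_mod_cast (Nat.succ_ne_zero (n + 1))
  have h3 : (n + 3 : ℂ) ≠ 0 := by exact_mod_cast (Nat.succ_ne_zero (n + 2))
  have hc : ∀ G : MvPolynomial (Fin 2) ℂ,
      G = C ((n + 1) * ((n + 2) * (n + 3)) : ℂ) * (C ((n + 1) * ((n + 2) * (n + 3)) : ℂ)⁻¹ * G) := by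
    intro G
    rw [← mul_assoc, ← C_mul, mul_inv_cancel₀ (mul_ne_zero h1 (mul_ne_zero h2 h3)), C_1, one_mul]
  have e30 := hc (partialD 3 0 F)
  have e21 := hc (partialD 2 1 F)
  have e12 := hc (partialD 1 2 F)
  have e03 := hc (partialD 0 3 F)
  have e20 := partialD_eq_of_lt hF (k := 2) (l := 0) (t := n) (by omega) e30 e21
  have e11 := partialD_eq_of_lt hF (k := 1) (l := 1) (t := n) (by omega) e21 e12
  have e02 := partialD_eq_of_lt hF (k := 0) (l := 2) (t := n) (by omega) e12 e03
  have hn : (n + 2 : ℂ) = (n + 1 : ℕ) + 1 := by push_cast; ring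
  have e10 := partialD_eq_of_lt hF (k := 1) (l := 0) (t := n + 1) (by omega) (c := n + 3)
    (by rw [← hn]; exact e20) (by rw [← hn]; exact e11)
  have e01 := partialD_eq_of_lt hF (k := 0) (l := 1) (t := n + 1) (by omega) (c := n + 3)
    (by rw [← hn]; exact e11) (by rw [← hn]; exact e02)
  have hn' : (n + 3 : ℂ) = ((n + 2 : ℕ) + 1) * 1 := by push_cast; ring
  have e00 := partialD_eq_of_lt hF (k := 0) (l := 0) (t := n + 2) (by omega) (c := 1)
    (by rw [← hn']; exact e10) (by rw [← hn']; exact e01)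
  rw [partialD_zero_zero, C_1, one_mul] at e00
  exact ⟨_, _, _, _, e30, e21, e12, e03, e20, e11, e02, e10, e01, e00⟩

theorem partialD_jacobian (A B : MvPolynomial (Fin 2) ℂ) :
    partialD 1 0 (rawTransvectant 1 A B) =
      partialD 2 0 A * partialD 0 1 B + partialD 1 0 A * partialD 1 1 B -
        (partialD 1 1 A * partialD 1 0 B + partialD 0 1 A * partialD 2 0 B) ∧
    partialD 0 1 (rawTransvectant 1 A B) =
      partialD 1 1 A * partialD 0 1 B + partialD 1 0 A * partialD 0 2 B -
        (partialD 0 2 A * partialD 1 0 B + partialD 0 1 A * partialD 1 1 B) := by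
  rw [rawTransvectant_one]
  constructor
  · rw [← zero_add 1, ← pderiv_zero_partialD 0 0 (_ - _), partialD_zero_zero]
    simp only [map_sub, pderiv_mul, pderiv_zero_partialD, Nat.reduceAdd]
  · rw [← zero_add 1, ← pderiv_one_partialD 0 0 (_ - _), partialD_zero_zero]
    simp only [map_sub, pderiv_mul, pderiv_one_partialD, Nat.reduceAdd]

theorem partialD_two_jacobian (A B : MvPolynomial (Fin 2) ℂ) :
    partialD 2 0 (rawTransvectant 1 A B) =
      partialD 3 0 A * partialD 0 1 B + 2 * (partialD 2 0 A * partialD 1 1 B) +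
        partialD 1 0 A * partialD 2 1 B - (partialD 2 1 A * partialD 1 0 B +
        2 * (partialD 1 1 A * partialD 2 0 B) + partialD 0 1 A * partialD 3 0 B) ∧
    partialD 1 1 (rawTransvectant 1 A B) =
      partialD 2 1 A * partialD 0 1 B + partialD 2 0 A * partialD 0 2 B +
        partialD 1 0 A * partialD 1 2 B - (partialD 1 2 A * partialD 1 0 B +
        partialD 0 2 A * partialD 2 0 B + partialD 0 1 A * partialD 2 1 B) ∧
    partialD 0 2 (rawTransvectant 1 A B) =
      partialD 1 2 A * partialD 0 1 B + 2 * (partialD 1 1 A * partialD 0 2 B) +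
        partialD 1 0 A * partialD 0 3 B - (partialD 0 3 A * partialD 1 0 B +
        2 * (partialD 0 2 A * partialD 1 1 B) + partialD 0 1 A * partialD 1 2 B) := by
  obtain ⟨h0, h1⟩ := partialD_jacobian A B
  refine ⟨?_, ?_, ?_⟩
  · rw [← pderiv_zero_partialD 1 0 (rawTransvectant 1 A B), h0]
    simp only [map_sub, map_add, pderiv_mul, pderiv_zero_partialD, Nat.reduceAdd]
    ring
  · rw [← pderiv_one_partialD 1 0 (rawTransvectant 1 A B), h0]
    simp only [map_sub, map_add, pderiv_mul, pderiv_one_partialD, Nat.reduceAdd]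
    ring
  · rw [← pderiv_one_partialD 0 1 (rawTransvectant 1 A B), h1]
    simp only [map_sub, map_add, pderiv_mul, pderiv_one_partialD, Nat.reduceAdd]
    ring

/-- `(n+1) ((A, B)₁, A)₂ = (n+3) (A, B)₃ A`, up to the normalizing factors. -/
theorem rawTransvectant_two_jacobian {n : ℕ} {A B : MvPolynomial (Fin 2) ℂ} (hA : A ∈ S (n + 3))
    (hB : B ∈ S (n + 3)) :
    C (n + 1 : ℂ) * rawTransvectant 2 (rawTransvectant 1 A B) A =
      C (n + 3 : ℂ) * (rawTransvectant 3 A B * A) := by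
  -- In terms of the third polars of `A` and `B`, both sides are explicit polynomials in `x₀, x₁`,
  -- the polars and `n`, and the identity holds formally.
  obtain ⟨a0, a1, a2, a3, a30, a21, a12, a03, a20, a11, a02, a10, a01, a00⟩ :=
    exists_third_polars hA
  obtain ⟨b0, b1, b2, b3, b30, b21, b12, b03, b20, b11, b02, b10, b01, b00⟩ :=
    exists_third_polars hB
  obtain ⟨h20, h11, h02⟩ := partialD_two_jacobian A B
  rw [rawTransvectant_two, rawTransvectant_three, h20, h11, h02, a30, a21, a12, a03, a20, a11, a02,
    a10, a01, b30, b21, b12, b03, b20, b11, b02, b10, b01]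
  conv_rhs => rw [a00]
  simp only [C_mul, C_add, map_ofNat, C_1]
  ring

/-- The combination on the left is chosen to cancel `N` when `(M,A)₂` and `(M,B)₂` are the same
multiple of `N A` and `N B`. Only second derivatives of `A` and `B` occur, so second polars suffice.
-/
theorem jacobian_of_rawTransvectant_two {n : ℕ} {A B M : MvPolynomial (Fin 2) ℂ}
    (hA : A ∈ S (n + 3)) (hB : B ∈ S (n + 3)) (hM : M ∈ S (2 * n + 4)) :
    C (n + 3 : ℂ) * (A * rawTransvectant 2 M B - B * rawTransvectant 2 M A) =
      C (2 * n + 3 : ℂ) * rawTransvectant 1 M (rawTransvectant 1 A B) := by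
  obtain ⟨a0, a1, a2, a20, a11, a02, a10, a01, a00⟩ := exists_second_polars (m := n + 1) hA
  obtain ⟨b0, b1, b2, b20, b11, b02, b10, b01, b00⟩ := exists_second_polars (m := n + 1) hB
  obtain ⟨p, q, r, m20, m11, m02, m10, m01, -⟩ := exists_second_polars (m := 2 * n + 2) hM
  obtain ⟨h10, h01⟩ := partialD_jacobian A B
  rw [rawTransvectant_two, rawTransvectant_two, rawTransvectant_one M, h10, h01, m20, m11, m02, m10,
    m01, a20, a11, a02, a10, a01, b20, b11, b02, b10, b01]
  conv_lhs => rw [a00, b00]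
  push_cast
  simp only [C_mul, C_add, map_ofNat, C_1]
  ring

/-! ### Monomial bases and the kernel of `psi`. -/

section

theorem rawTransvectant_mem {e f r : ℕ} (he : r ≤ e) (hf : r ≤ f) {E F : MvPolynomial (Fin 2) ℂ}
    (hE : E ∈ S e) (hF : F ∈ S f) : rawTransvectant r E F ∈ S (e + f - 2 * r) := by
  refine Submodule.sum_mem _ fun i hi => Submodule.smul_mem _ _ ?_
  have hi' : i ≤ r := by simpa [Nat.lt_succ_iff] using hi
  have h := ((mem_homogeneousSubmodule _ _).1 (partialD_mem (r - i) i hE)).mul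
    ((mem_homogeneousSubmodule _ _).1 (partialD_mem i (r - i) hF))
  rw [mem_homogeneousSubmodule]
  convert h using 1
  omega

theorem rawTransvectant_smul_left (r : ℕ) (c : ℂ) (E F : MvPolynomial (Fin 2) ℂ) :
    rawTransvectant r (c • E) F = c • rawTransvectant r E F := by
  simp only [rawTransvectant, map_smul, smul_mul_assoc, Finset.smul_sum]
  exact Finset.sum_congr rfl fun i _ => smul_comm _ _ _

theorem rawTransvectant_smul_right (r : ℕ) (c : ℂ) (E F : MvPolynomial (Fin 2) ℂ) :
    rawTransvectant r E (c • F) = c • rawTransvectant r E F := by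
  simp only [rawTransvectant, map_smul, mul_smul_comm, Finset.smul_sum]
  exact Finset.sum_congr rfl fun i _ => smul_comm _ _ _

theorem rawTransvectant_add_right (r : ℕ) (E F G : MvPolynomial (Fin 2) ℂ) :
    rawTransvectant r E (F + G) = rawTransvectant r E F + rawTransvectant r E G := by
  simp only [rawTransvectant, map_add, mul_add, smul_add, Finset.sum_add_distrib]

/-- The Jacobian of two linearly independent forms of the same order does not vanish. -/
theorem rawTransvectant_one_ne_zero {m : ℕ} (hm : 1 ≤ m) {E F : S m}
    (h : LinearIndependent ℂ ![E, F]) :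
    rawTransvectant 1 (E : MvPolynomial (Fin 2) ℂ) F ≠ 0 := by
  have h1 := wronskian_ne_zero (by omega) h
  rwa [wronskian, Matrix.det_fin_two, Matrix.of_apply, Matrix.of_apply, Matrix.of_apply,
    Matrix.of_apply, Fin.val_zero, Fin.val_one, ← rawTransvectant_one] at h1

theorem exists_smul_eq_of_rawTransvectant_one {m : ℕ} (hm : 1 ≤ m) {E F : S m} (hE : E ≠ 0)
    (h : rawTransvectant 1 (E : MvPolynomial (Fin 2) ℂ) F = 0) : ∃ c : ℂ, c • E = F := by
  by_contra! hc
  exact rawTransvectant_one_ne_zero hm ((LinearIndependent.pair_iff' hE).2 hc) h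

/-- The exponent of the monomial `x₀^s x₁^(d-s)`. -/
def expo (d s : ℕ) : Fin 2 →₀ ℕ := Finsupp.single 0 s + Finsupp.single 1 (d - s)

theorem expo_zero (d s : ℕ) : expo d s 0 = s := by simp [expo]

theorem expo_one (d s : ℕ) : expo d s 1 = d - s := by simp [expo]

theorem basisForm_eq_monomial (d : ℕ) (s : Fin (d + 1)) :
    (basisForm d s : MvPolynomial (Fin 2) ℂ) = monomial (expo d s) 1 := by
  rw [expo, ← one_mul (1 : ℂ), ← monomial_mul, ← X_pow_eq_monomial, ← X_pow_eq_monomial]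
  rfl

theorem degree_eq_of_mem {d : ℕ} {F : MvPolynomial (Fin 2) ℂ} (hF : F ∈ S d) {k : Fin 2 →₀ ℕ}
    (hk : coeff k F ≠ 0) : k 0 + k 1 = d := by
  have h := ((mem_homogeneousSubmodule _ _).1 hF) hk
  rw [Finsupp.weight_apply, Finsupp.sum_fintype _ _ (by simp)] at h
  simpa using h

theorem expo_eq {d : ℕ} {k : Fin 2 →₀ ℕ} (hk : k 0 + k 1 = d) : expo d (k 0) = k := by
  ext i
  fin_cases i
  · exact expo_zero _ _
  · refine (expo_one _ _).trans ?_
    change d - k 0 = k 1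
    omega

theorem coeff_basisForm (d : ℕ) (i j : Fin (d + 1)) :
    coeff (expo d i) (basisForm d j : MvPolynomial (Fin 2) ℂ) = if j = i then 1 else 0 := by
  rw [basisForm_eq_monomial, coeff_monomial]
  refine if_congr ⟨fun h => ?_, fun h => by rw [h]⟩ rfl rfl
  have := DFunLike.congr_fun h 0
  rw [expo_zero, expo_zero] at this
  exact Fin.ext this

theorem eq_sum_basisForm {d : ℕ} (F : S d) :
    F = ∑ i : Fin (d + 1), coeff (expo d i) (F : MvPolynomial (Fin 2) ℂ) • basisForm d i := by
  ext k
  simp only [AddSubmonoidClass.coe_finsetSum, SetLike.val_smul, coeff_sum, coeff_smul,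
    smul_eq_mul]
  by_cases hk : k 0 + k 1 = d
  · obtain ⟨i, rfl⟩ : ∃ i : Fin (d + 1), k = expo d i := ⟨⟨k 0, by omega⟩, (expo_eq hk).symm⟩
    simp [coeff_basisForm]
  · have h0 : ∀ G : S d, coeff k (G : MvPolynomial (Fin 2) ℂ) = 0 := fun G => by
      by_contra h
      exact hk (degree_eq_of_mem G.2 h)
    simp [h0]

/-- The basis of `S_d` consisting of the monomials `x₀^s x₁^(d-s)`. -/
def formBasis (d : ℕ) : Module.Basis (Fin (d + 1)) ℂ (S d) :=
  Module.Basis.ofEquivFun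
    { toFun := fun F i => coeff (expo d i) (F : MvPolynomial (Fin 2) ℂ)
      map_add' := fun F G => by ext i; simp
      map_smul' := fun c F => by ext i; simp
      invFun := fun c => ∑ i, c i • basisForm d i
      left_inv := fun F => (eq_sum_basisForm F).symm
      right_inv := fun c => by
        ext i
        simp [coeff_sum, coeff_basisForm] }

theorem formBasis_repr_apply (d : ℕ) (F : S d) (i : Fin (d + 1)) :
    (formBasis d).repr F i = coeff (expo d i) (F : MvPolynomial (Fin 2) ℂ) := rfl

theorem formBasis_apply (d : ℕ) (i : Fin (d + 1)) : formBasis d i = basisForm d i := by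
  refine (formBasis d).repr.injective (Finsupp.ext fun j => ?_)
  rw [Module.Basis.repr_self, formBasis_repr_apply, coeff_basisForm, Finsupp.single_apply]

instance (d : ℕ) : Module.Finite ℂ (S d) := Module.Finite.of_basis (formBasis d)

theorem exists_linearIndependent_pair {V : Type*} [AddCommGroup V] [Module ℂ V]
    (h : 1 < Module.finrank ℂ V) {x : V} (hx : x ≠ 0) : ∃ y, LinearIndependent ℂ ![x, y] :=
  exists_linearIndependent_pair_of_one_lt_finrank h hx

theorem two_le_finrank_of_mem {V : Type*} [AddCommGroup V] [Module ℂ V] [Module.Finite ℂ V]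
    {K : Submodule ℂ V} {A B : V} (hA : A ∈ K) (hB : B ∈ K) (h : LinearIndependent ℂ ![A, B]) :
    2 ≤ Module.finrank ℂ K := by
  have hli : LinearIndependent ℂ ![(⟨A, hA⟩ : K), ⟨B, hB⟩] := by
    refine LinearIndependent.of_comp K.subtype ?_
    convert h using 1
    ext1 i
    fin_cases i <;> rfl
  simpa using hli.fintype_card_le_finrank

variable {n : ℕ} {hd : 3 ≤ n + 3} {M : S (2 * (n + 3) - 2)} {N : S (2 * (n + 3) - 6)}

/-- The constant is `(d-2)/(4d-6)` divided by the normalizing factor `1/((2d-2)(2d-3)d(d-1))` of the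
second transvectant, at `d = n + 3`. -/
theorem psi_eq_zero_iff (F : S (n + 3)) : psi (n + 3) hd M N F = 0 ↔
    rawTransvectant 2 (M : MvPolynomial (Fin 2) ℂ) F =
      ((n + 1) * (n + 2) ^ 2 * (n + 3) : ℂ) • ((N : MvPolynomial (Fin 2) ℂ) * F) := by
  have h1 : (n + 1 : ℂ) ≠ 0 := by exact_mod_cast (Nat.succ_ne_zero n)
  have h2 : (n + 2 : ℂ) ≠ 0 := by exact_mod_cast (Nat.succ_ne_zero (n + 1))
  have h3 : (n + 3 : ℂ) ≠ 0 := by exact_mod_cast (Nat.succ_ne_zero (n + 2))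
  have h4 : (2 * n + 3 : ℂ) ≠ 0 := by exact_mod_cast (Nat.succ_ne_zero (2 * n + 2))
  have hf : ((n + 1).factorial : ℂ) ≠ 0 := by exact_mod_cast Nat.factorial_ne_zero _
  have hf' : ((2 * n + 2).factorial : ℂ) ≠ 0 := by exact_mod_cast Nat.factorial_ne_zero _
  have key : (psi (n + 3) hd M N F : MvPolynomial (Fin 2) ℂ) =
      (1 / (2 * (n + 2) ^ 2 * (2 * n + 3) * (n + 3)) : ℂ) •
        (rawTransvectant 2 (M : MvPolynomial (Fin 2) ℂ) F -
          ((n + 1) * (n + 2) ^ 2 * (n + 3) : ℂ) • ((N : MvPolynomial (Fin 2) ℂ) * F)) := by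
    change transvectant (2 * (n + 3) - 2) (n + 3) 2 M F - _ • (_ * _) = _
    rw [transvectant_eq, smul_sub, smul_smul]
    congr 2
    · rw [show 2 * (n + 3) - 2 - 2 = 2 * n + 2 by omega, show n + 3 - 2 = n + 1 by omega,
        show 2 * (n + 3) - 2 = 2 * n + 4 by omega, Nat.factorial_succ (2 * n + 3),
        Nat.factorial_succ (2 * n + 2), Nat.factorial_succ (n + 2), Nat.factorial_succ (n + 1)]
      push_cast
      rw [show (2 * n + 3 + 1 : ℂ) = 2 * (n + 2) by ring,
        show (2 * n + 2 + 1 : ℂ) = 2 * n + 3 by ring, show (n + 2 + 1 : ℂ) = n + 3 by ring,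
        show (n + 1 + 1 : ℂ) = n + 2 by ring]
      field_simp
    · push_cast
      rw [show (4 * (n + 3) - 6 : ℂ) = 2 * (2 * n + 3) by ring,
        show (n + 3 - 2 : ℂ) = n + 1 by ring]
      field_simp
  rw [← Submodule.coe_eq_zero, key, smul_eq_zero, sub_eq_zero, or_iff_right]
  exact one_div_ne_zero (mul_ne_zero (mul_ne_zero (mul_ne_zero two_ne_zero (pow_ne_zero 2 h2)) h4) h3)

/-- For kernel elements the left side of `jacobian_of_rawTransvectant_two` is a multiple of `A·NB -
B·NA = 0`; so `M` and `(A,B)₁`, both of order `2d - 2`, have zero Jacobian. -/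
theorem exists_jacobian_eq_smul (hM : M ≠ 0) {A B : S (n + 3)} (hA : psi (n + 3) hd M N A = 0)
    (hB : psi (n + 3) hd M N B = 0) :
    ∃ c : ℂ, rawTransvectant 1 (A : MvPolynomial (Fin 2) ℂ) B =
      c • (M : MvPolynomial (Fin 2) ℂ) := by
  rw [psi_eq_zero_iff] at hA hB
  have hJ := rawTransvectant_mem (by omega : 1 ≤ n + 3) (by omega : 1 ≤ n + 3) A.2 B.2
  rw [show n + 3 + (n + 3) - 2 * 1 = 2 * (n + 3) - 2 by omega] at hJ
  have h := jacobian_of_rawTransvectant_two A.2 B.2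
    (M := (M : MvPolynomial (Fin 2) ℂ)) (by convert M.2 using 2; omega)
  have h0 : rawTransvectant 1 (M : MvPolynomial (Fin 2) ℂ)
      (rawTransvectant 1 (A : MvPolynomial (Fin 2) ℂ) B) = 0 := by
    rw [hA, hB] at h
    have hC : (C (2 * n + 3 : ℂ) : MvPolynomial (Fin 2) ℂ) ≠ 0 := by
      rw [Ne, C_eq_zero]
      exact_mod_cast (Nat.succ_ne_zero (2 * n + 2))
    refine (mul_eq_zero.1 (h.symm.trans ?_)).resolve_left hC
    simp only [smul_eq_C_mul]
    ring
  obtain ⟨c, hc⟩ := exists_smul_eq_of_rawTransvectant_one (by omega) (F := ⟨_, hJ⟩) hM h0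
  exact ⟨c, (congrArg Subtype.val hc).symm⟩

/-- `rawTransvectant_two_jacobian` for `(A, B)`, and for `(B, A)`, where both odd transvectants
change sign. -/
theorem psi_eq_zero_of_transvectants {A B : S (n + 3)}
    (hM : (M : MvPolynomial (Fin 2) ℂ) = transvectant (n + 3) (n + 3) 1 A B)
    (hN : (N : MvPolynomial (Fin 2) ℂ) = transvectant (n + 3) (n + 3) 3 A B) :
    psi (n + 3) hd M N A = 0 ∧ psi (n + 3) hd M N B = 0 := by
  have h1 : (n + 1 : ℂ) ≠ 0 := by exact_mod_cast (Nat.succ_ne_zero n)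
  have h2 : (n + 2 : ℂ) ≠ 0 := by exact_mod_cast (Nat.succ_ne_zero (n + 1))
  have h3 : (n + 3 : ℂ) ≠ 0 := by exact_mod_cast (Nat.succ_ne_zero (n + 2))
  have hM' := (rawTransvectant_one_eq n (A : MvPolynomial (Fin 2) ℂ) B).trans
    (congrArg _ hM.symm)
  have hN' := (rawTransvectant_three_eq n (A : MvPolynomial (Fin 2) ℂ) B).trans
    (congrArg _ hN.symm)
  have hA := rawTransvectant_two_jacobian A.2 B.2
  have hB := rawTransvectant_two_jacobian B.2 A.2
  rw [rawTransvectant_swap 1 (A : MvPolynomial (Fin 2) ℂ),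
    rawTransvectant_swap 3 (A : MvPolynomial (Fin 2) ℂ)] at hB
  rw [hM', hN'] at hA hB
  simp only [rawTransvectant_smul_left, ← smul_eq_C_mul, smul_smul, smul_mul_assoc] at hA hB
  have hc : ((n + 1) * (n + 3) ^ 2 : ℂ) ≠ 0 := mul_ne_zero h1 (pow_ne_zero 2 h3)
  rw [psi_eq_zero_iff, psi_eq_zero_iff]
  constructor
  · refine smul_right_injective _ hc ?_
    simp only [smul_smul]
    rw [hA]
    congr 1
    ring
  · refine smul_right_injective _ hc ?_
    simp only [smul_smul]
    rw [← neg_inj, ← neg_smul, ← neg_smul]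
    convert hB using 2 <;> ring

theorem transvectants_iff_finrank_ker (hM : M ≠ 0) :
    (∃ A B : S (n + 3), LinearIndependent ℂ ![A, B] ∧
      (M : MvPolynomial (Fin 2) ℂ) = transvectant (n + 3) (n + 3) 1 A B ∧
      (N : MvPolynomial (Fin 2) ℂ) = transvectant (n + 3) (n + 3) 3 A B) ↔
    2 ≤ Module.finrank ℂ (LinearMap.ker (psi (n + 3) hd M N)) := by
  have h1 : (n + 1 : ℂ) ≠ 0 := by exact_mod_cast (Nat.succ_ne_zero n)
  have h2 : (n + 2 : ℂ) ≠ 0 := by exact_mod_cast (Nat.succ_ne_zero (n + 1))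
  have h3 : (n + 3 : ℂ) ≠ 0 := by exact_mod_cast (Nat.succ_ne_zero (n + 2))
  constructor
  · rintro ⟨A, B, hAB, hMt, hNt⟩
    obtain ⟨hA, hB⟩ := psi_eq_zero_of_transvectants (hd := hd) hMt hNt
    exact two_le_finrank_of_mem hA hB hAB
  · intro h
    have hnt : Nontrivial (LinearMap.ker (psi (n + 3) hd M N)) :=
      Module.nontrivial_of_finrank_pos (R := ℂ) (by omega)
    obtain ⟨A, hA0⟩ := exists_ne (0 : LinearMap.ker (psi (n + 3) hd M N))
    have hlt : 1 < Module.finrank ℂ (LinearMap.ker (psi (n + 3) hd M N)) := h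
    obtain ⟨B, hAB⟩ := exists_linearIndependent_pair
      (V := LinearMap.ker (psi (n + 3) hd M N)) hlt hA0
    have hli : LinearIndependent ℂ ![(A : S (n + 3)), (B : S (n + 3))] := by
      have h4 := hAB.map' (LinearMap.ker (psi (n + 3) hd M N)).subtype (Submodule.ker_subtype _)
      have h5 : (LinearMap.ker (psi (n + 3) hd M N)).subtype ∘ ![A, B] =
          ![(A : S (n + 3)), (B : S (n + 3))] := by
        ext1 i
        fin_cases i <;> rfl
      rwa [h5] at h4
    obtain ⟨c, hc⟩ := exists_jacobian_eq_smul hM A.2 B.2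
    have hc0 : c ≠ 0 := by
      rintro rfl
      rw [zero_smul] at hc
      exact rawTransvectant_one_ne_zero (by omega) hli hc
    -- Chosen so that the normalized first transvectant of `a • A` and `B` is exactly `M`.
    set a : ℂ := (n + 3) ^ 2 / c with ha
    have ha0 : a ≠ 0 := div_ne_zero (pow_ne_zero 2 h3) hc0
    have hMt : (M : MvPolynomial (Fin 2) ℂ) = transvectant (n + 3) (n + 3) 1
        ((a • (A : S (n + 3)) : S (n + 3)) : MvPolynomial (Fin 2) ℂ) (B : S (n + 3)) := by
      refine smul_right_injective _ (pow_ne_zero 2 h3) ?_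
      simp only
      rw [← rawTransvectant_one_eq n, Submodule.coe_smul, rawTransvectant_smul_left, hc, smul_smul,
        ha, div_mul_cancel₀ _ hc0]
    have hmem : transvectant (n + 3) (n + 3) 3 ((a • (A : S (n + 3)) : S (n + 3)) :
        MvPolynomial (Fin 2) ℂ) (B : S (n + 3)) ∈ S (2 * (n + 3) - 6) := by
      have h4 := Submodule.smul_mem _ (((n + 3 - 3).factorial : ℂ) * ((n + 3 - 3).factorial : ℂ) /
        (((n + 3).factorial : ℂ) * ((n + 3).factorial : ℂ)))
        (rawTransvectant_mem (by omega : 3 ≤ n + 3) (by omega : 3 ≤ n + 3)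
        (a • (A : S (n + 3))).2 (B : S (n + 3)).2)
      rw [transvectant_eq]
      convert h4 using 2
      omega
    have hA' : psi (n + 3) hd M N (a • (A : S (n + 3))) = 0 := by
      rw [map_smul, LinearMap.mem_ker.1 A.2, smul_zero]
    -- Now `a • A` is killed by `ψ` both for `N` and for the third transvectant in place of `N`;
    -- cancelling `a • A` identifies the two.
    have hA'' := (psi_eq_zero_of_transvectants (hd := hd) (N := ⟨_, hmem⟩) hMt rfl).1
    rw [psi_eq_zero_iff] at hA' hA''
    rw [hA'] at hA''
    have hk : ((n + 1) * (n + 2) ^ 2 * (n + 3) : ℂ) ≠ 0 :=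
      mul_ne_zero (mul_ne_zero h1 (pow_ne_zero 2 h2)) h3
    have hne : ((a • (A : S (n + 3)) : S (n + 3)) : MvPolynomial (Fin 2) ℂ) ≠ 0 := by
      rw [Ne, Submodule.coe_eq_zero]
      exact smul_ne_zero ha0 (by simpa using hA0)
    refine ⟨a • (A : S (n + 3)), B, ?_, hMt, mul_right_cancel₀ hne (smul_right_injective _ hk hA'')⟩
    rw [LinearIndependent.pair_iff] at hli ⊢
    intro s t hst
    rw [smul_smul] at hst
    obtain ⟨h5, h6⟩ := hli _ _ hst
    exact ⟨(mul_eq_zero.1 h5).resolve_right ha0, h6⟩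

/-- `F ↦ (A,F)₁` sends the kernel to the line spanned by `M`, and its own kernel there is the line
spanned by `A`. -/
theorem finrank_ker_psi_le (hM : M ≠ 0) :
    Module.finrank ℂ (LinearMap.ker (psi (n + 3) hd M N)) ≤ 2 := by
  by_contra! h
  have hnt : Nontrivial (LinearMap.ker (psi (n + 3) hd M N)) :=
    Module.nontrivial_of_finrank_pos (R := ℂ) (by omega)
  obtain ⟨A, hA0⟩ := exists_ne (0 : LinearMap.ker (psi (n + 3) hd M N))
  have hA0' : (A : S (n + 3)) ≠ 0 := by simpa using hA0
  have hj : ∀ F : LinearMap.ker (psi (n + 3) hd M N), ∃ c : ℂ,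
      rawTransvectant 1 ((A : S (n + 3)) : MvPolynomial (Fin 2) ℂ) (F : S (n + 3)) =
        c • (M : MvPolynomial (Fin 2) ℂ) := fun F => exists_jacobian_eq_smul hM A.2 F.2
  have hspan : ∀ F : LinearMap.ker (psi (n + 3) hd M N),
      rawTransvectant 1 ((A : S (n + 3)) : MvPolynomial (Fin 2) ℂ) (F : S (n + 3)) = 0 →
        ∃ t : ℂ, t • A = F := by
    intro F hF
    obtain ⟨t, ht⟩ := exists_smul_eq_of_rawTransvectant_one (by omega) hA0' hF
    exact ⟨t, Subtype.ext ht⟩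
  obtain ⟨B, hAB⟩ := exists_linearIndependent_pair
    (V := LinearMap.ker (psi (n + 3) hd M N)) (one_lt_two.trans h) hA0
  obtain ⟨c, hc⟩ := hj B
  have hc0 : c ≠ 0 := by
    rintro rfl
    rw [zero_smul] at hc
    obtain ⟨t, ht⟩ := hspan B hc
    exact (LinearIndependent.pair_iff' hA0).1 hAB t ht
  have htop : (⊤ : Submodule ℂ (LinearMap.ker (psi (n + 3) hd M N))) ≤
      Submodule.span ℂ (Set.range ![A, B]) := by
    intro F _
    obtain ⟨b, hb⟩ := hj F
    -- The multiple `-b/c` of `B` cancels the Jacobian of `F` with `A`.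
    obtain ⟨t, ht⟩ := hspan (F + (-(b / c)) • B) (by
      rw [Submodule.coe_add, Submodule.coe_smul, Submodule.coe_add, Submodule.coe_smul,
        rawTransvectant_add_right, rawTransvectant_smul_right, hb, hc, smul_smul, ← add_smul]
      field_simp
      simp)
    rw [Matrix.range_cons_cons_empty, Submodule.mem_span_pair]
    refine ⟨t, b / c, ?_⟩
    rw [ht, add_assoc, ← add_smul, neg_add_cancel, zero_smul, add_zero]
  have h1 := Submodule.finrank_mono htop
  rw [finrank_top] at h1
  have h2 := finrank_range_le_card (R := ℂ) ![A, B]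
  rw [Fintype.card_fin, Set.finrank] at h2
  omega

end

/-! ### The forms `w_i` and the vanishing of `Phi`. -/

section

theorem wronskian_mem {q m : ℕ} {F : Fin q → MvPolynomial (Fin 2) ℂ} (hF : ∀ i, F i ∈ S m) :
    wronskian F ∈ S (q * (m - (q - 1))) := by
  rw [wronskian, Matrix.det_apply]
  refine Submodule.sum_mem _ fun σ _ => ?_
  rw [Units.smul_def, ← Int.cast_smul_eq_zsmul ℂ]
  refine Submodule.smul_mem _ _ ?_
  rw [mem_homogeneousSubmodule]
  have h := IsHomogeneous.prod Finset.univ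
    (fun j : Fin q => partialD (q - 1 - (j : ℕ)) (j : ℕ) (F (σ j))) (fun _ => m - (q - 1))
    fun j _ => by
      have h1 := (mem_homogeneousSubmodule _ _).1
        (partialD_mem (q - 1 - (j : ℕ)) (j : ℕ) (hF (σ j)))
      rwa [show q - 1 - (j : ℕ) + j = q - 1 by omega] at h1
  rw [Finset.sum_const, Finset.card_univ, Fintype.card_fin, smul_eq_mul] at h
  exact h

variable {d : ℕ} {hd : 3 ≤ d} {M : S (2 * d - 2)} {N : S (2 * d - 6)}

theorem w_mem (i : Fin (d + 1)) : w d hd M N i ∈ S (d * (2 * d - 5)) := by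
  have h := wronskian_mem (F := fun s : Fin d =>
    (psi d hd M N (basisForm d (i.succAbove s)) : MvPolynomial (Fin 2) ℂ)) fun s => Subtype.prop _
  rw [show 3 * d - 6 - (d - 1) = 2 * d - 5 by omega] at h
  rw [w]
  rcases neg_one_pow_eq_or (MvPolynomial (Fin 2) ℂ) i with h1 | h1
  · rw [h1, one_mul]; exact h
  · rw [h1, neg_one_mul]; exact Submodule.neg_mem _ h

/-- The tensor `∑ i, w_i(x) e_i(y)`, with `e_i = x₀^i x₁^(d-i)`. -/
def wTensor (d : ℕ) (hd : 3 ≤ d) (M : S (2 * d - 2)) (N : S (2 * d - 6)) :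
    MvPolynomial (Fin 2 ⊕ Fin 2) ℂ :=
  ∑ i : Fin (d + 1), inX (w d hd M N i) * inY (basisForm d i)

theorem bihom_wTensor : Bihom (d * (2 * d - 5) : ℕ) d (wTensor d hd M N) :=
  Bihom.sum fun i _ => ((bihom_inX (w_mem i)).mul (bihom_inY (basisForm d i).2)).congr
    (add_zero _) (zero_add _)

theorem Phi_eq (r : ℕ) : Phi d hd r M N =
    ((((d * (2 * d - 5) - r).factorial : ℂ) * ((d - r).factorial : ℂ)) /
      (((d * (2 * d - 5)).factorial : ℂ) * (d.factorial : ℂ))) •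
      diag ((cayley ^ r) (wTensor d hd M N)) := by
  simp only [Phi, transvectant_eq, wTensor, map_sum, diag_cayley_pow_inX_mul_inY, Finset.smul_sum]

/-- Setting `y₀ = t`, `y₁ = 1` turns the sum into a polynomial in `t` whose coefficients are the `W
i`. -/
theorem eq_zero_of_sum_inX_mul_inY {W : Fin (d + 1) → MvPolynomial (Fin 2) ℂ}
    (h : ∑ i, inX (W i) * inY (basisForm d i : MvPolynomial (Fin 2) ℂ) = 0) (i : Fin (d + 1)) :
    W i = 0 := by
  set φ : MvPolynomial (Fin 2 ⊕ Fin 2) ℂ →ₐ[ℂ] Polynomial (MvPolynomial (Fin 2) ℂ) :=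
    aeval (Sum.elim (fun i => Polynomial.C (X i)) ![Polynomial.X, 1]) with hφ
  have hX : ∀ E, φ (inX E) = Polynomial.C E := by
    intro E
    have : φ.comp (rename Sum.inl) = Polynomial.CAlgHom (R := ℂ) (A := MvPolynomial (Fin 2) ℂ) :=
      algHom_ext fun j => by simp [hφ]
    exact DFunLike.congr_fun this E
  have hY : ∀ j : Fin (d + 1), φ (inY (basisForm d j)) = Polynomial.X ^ (j : ℕ) := by
    intro j
    simp [hφ, inY, basisForm]
  have h1 := congrArg (fun p => Polynomial.coeff (φ p) i) h
  simpa [hX, hY, Polynomial.coeff_C_mul, Polynomial.coeff_X_pow, Fin.val_inj] using h1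

/-- The `d + 1` conditions make the tensor divisible by `ω^(d+1)`, too high a power for its degree
`d` in `y`. -/
theorem Phi_eq_zero_iff : (∀ r, r ≤ d → Phi d hd r M N = 0) ↔ ∀ i, w d hd M N i = 0 := by
  constructor
  · intro h
    have hle : d ≤ d * (2 * d - 5) := Nat.le_mul_of_pos_right d (by omega)
    refine eq_zero_of_sum_inX_mul_inY ((bihom_wTensor.omega_pow_dvd (n := d + 1) (by omega)
      fun r hr => ?_).2 (Nat.lt_succ_self d))
    have h1 := h r (by omega)
    rw [Phi_eq] at h1
    exact (smul_eq_zero.1 h1).resolve_left (transvectant_factor_ne_zero _ _ _)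
  · intro h r _
    rw [Phi_eq, wTensor]
    simp [h, inX]

/-- The Wronskian detects a linear relation among the images of all monomials except the `i`-th,
that is, a kernel vector without that monomial. -/
theorem w_eq_zero_iff (i : Fin (d + 1)) : w d hd M N i = 0 ↔
    ∃ v : S d, v ≠ 0 ∧ psi d hd M N v = 0 ∧ (formBasis d).repr v i = 0 := by
  have hw : w d hd M N i = 0 ↔ wronskian (fun s : Fin d =>
      (psi d hd M N (basisForm d (i.succAbove s)) : MvPolynomial (Fin 2) ℂ)) = 0 := by
    rw [w, mul_eq_zero, or_iff_right (pow_ne_zero _ (neg_ne_zero.2 one_ne_zero))]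
  rw [hw]
  constructor
  · intro h
    have h1 : ¬ LinearIndependent ℂ fun s : Fin d =>
        psi d hd M N (basisForm d (i.succAbove s)) := fun hli =>
      -- The side condition is `d ≤ (3d - 6) + 1`.
      wronskian_ne_zero (by omega) hli h
    obtain ⟨g, hg, s, hs⟩ := Fintype.not_linearIndependent_iff.1 h1
    have hr : ∀ j, (formBasis d).repr (∑ s, g s • basisForm d (i.succAbove s)) j =
        ∑ s, g s * if i.succAbove s = j then 1 else 0 := by
      intro j
      simp only [← formBasis_apply, map_sum, map_smul, Module.Basis.repr_self, Finsupp.finsetSum_apply,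
        Finsupp.smul_apply, smul_eq_mul, Finsupp.single_apply]
    refine ⟨∑ s, g s • basisForm d (i.succAbove s), fun h0 => hs ?_, ?_, ?_⟩
    · have h2 := hr (i.succAbove s)
      rw [h0] at h2
      simpa [Fin.succAbove_right_inj] using h2.symm
    · simpa only [map_sum, map_smul] using hg
    · rw [hr]
      simp [Fin.succAbove_ne]
  · rintro ⟨v, hv0, hv, hvi⟩
    refine wronskian_eq_zero (a := fun s => (formBasis d).repr v (i.succAbove s)) ?_ ?_
    · intro h0
      refine hv0 ((formBasis d).repr.map_eq_zero_iff.1 (Finsupp.ext fun j => ?_))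
      rcases Fin.eq_self_or_eq_succAbove i j with rfl | ⟨s, rfl⟩
      · exact hvi
      · exact congrFun h0 s
    · have h1 := congrArg (psi d hd M N) ((formBasis d).sum_repr v)
      rw [Fin.sum_univ_succAbove _ i, hvi, zero_smul, zero_add, hv, map_sum] at h1
      have h2 := congrArg Subtype.val h1
      simpa only [map_smul, formBasis_apply, AddSubmonoidClass.coe_finsetSum,
        SetLike.val_smul, ZeroMemClass.coe_zero] using h2

/-- A space of dimension at least 2 meets every coordinate hyperplane. Conversely, a nonzero kernel
vector `u` has some coordinate `j` nonzero, and the kernel vector supplied for that `j` is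
independent of `u`. -/
theorem two_le_finrank_ker_iff : 2 ≤ Module.finrank ℂ (LinearMap.ker (psi d hd M N)) ↔
    ∀ i, w d hd M N i = 0 := by
  simp only [w_eq_zero_iff]
  constructor
  · intro h i
    have hnt : Nontrivial (LinearMap.ker (psi d hd M N)) :=
      Module.nontrivial_of_finrank_pos (R := ℂ) (by omega)
    obtain ⟨A, hA0⟩ := exists_ne (0 : LinearMap.ker (psi d hd M N))
    have hlt : 1 < Module.finrank ℂ (LinearMap.ker (psi d hd M N)) := h
    obtain ⟨B, hAB⟩ := exists_linearIndependent_pair (V := LinearMap.ker (psi d hd M N)) hlt hA0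
    by_cases hi : (formBasis d).repr (A : S d) i = 0
    · exact ⟨A, by simpa using hA0, A.2, hi⟩
    · refine ⟨((formBasis d).repr (B : S d) i • A + (-(formBasis d).repr (A : S d) i) • B :
        LinearMap.ker (psi d hd M N)), ?_,
        LinearMap.mem_ker.1 (Subtype.prop _), ?_⟩
      · rw [Ne, ZeroMemClass.coe_eq_zero]
        intro h0
        exact hi (neg_eq_zero.1 ((LinearIndependent.pair_iff.1 hAB _ _ h0).2))
      · simp [mul_comm]
  · intro h
    obtain ⟨u, hu0, hu, -⟩ := h 0
    obtain ⟨j, hj⟩ : ∃ j, (formBasis d).repr u j ≠ 0 := by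
      by_contra! hc
      exact hu0 ((formBasis d).repr.map_eq_zero_iff.1 (Finsupp.ext hc))
    obtain ⟨v, hv0, hv, hvj⟩ := h j
    refine two_le_finrank_of_mem (LinearMap.mem_ker.2 hu) (LinearMap.mem_ker.2 hv)
      (LinearIndependent.pair_iff.2 fun s t h1 => ?_)
    have h2 := DFunLike.congr_fun (congrArg (formBasis d).repr h1) j
    simp only [map_add, map_smul, Finsupp.add_apply, Finsupp.smul_apply, hvj,
      smul_eq_mul, mul_zero, add_zero, map_zero, Finsupp.zero_apply] at h2
    have hs := (mul_eq_zero.1 h2).resolve_right hj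
    rw [hs, zero_smul, zero_add] at h1
    exact ⟨hs, (smul_eq_zero.1 h1).resolve_right hv0⟩

theorem Phi_mem {r : ℕ} (hr : r ≤ d) : Phi d hd r M N ∈ S (d * (2 * d - 4) - 2 * r) := by
  have hle : d ≤ d * (2 * d - 5) := Nat.le_mul_of_pos_right d (by omega)
  refine Submodule.sum_mem _ fun i _ => ?_
  have h := Submodule.smul_mem _ (((((d * (2 * d - 5) - r).factorial : ℂ) *
    ((d - r).factorial : ℂ)) / (((d * (2 * d - 5)).factorial : ℂ) * (d.factorial : ℂ))))
    (rawTransvectant_mem (hr.trans hle) hr (w_mem (hd := hd) (M := M) (N := N) i)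
      (basisForm d i).2)
  rw [transvectant_eq]
  convert h using 3
  rw [show 2 * d - 4 = 2 * d - 5 + 1 by omega, Nat.mul_succ]

end

/-! ### Polynomial dependence on the coefficients of `M` and `N`. -/

section

/-- The coefficients of `Ψ(M, N)` are homogeneous polynomials of degree `n` in the coefficients
of `M` and `N`. -/
def HasPolynomialCoeffs (a b n : ℕ) (Ψ : S a → S b → MvPolynomial (Fin 2) ℂ) : Prop :=
  ∃ P : (Fin 2 →₀ ℕ) → MvPolynomial ((Fin 2 →₀ ℕ) ⊕ (Fin 2 →₀ ℕ)) ℂ,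
    (∀ k, (P k).IsHomogeneous n) ∧
    ∀ (M : S a) (N : S b) (k : Fin 2 →₀ ℕ),
      coeff k (Ψ M N) =
        eval (Sum.elim (fun l => coeff l (M : MvPolynomial (Fin 2) ℂ))
          (fun l => coeff l (N : MvPolynomial (Fin 2) ℂ))) (P k)

namespace HasPolynomialCoeffs

variable {a b n n' : ℕ} {Ψ Ψ' : S a → S b → MvPolynomial (Fin 2) ℂ}

theorem fst : HasPolynomialCoeffs a b 1 fun M _ => M :=
  ⟨fun k => X (Sum.inl k), fun _ => isHomogeneous_X _ _, fun M N k => by simp⟩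

theorem snd : HasPolynomialCoeffs a b 1 fun _ N => N :=
  ⟨fun k => X (Sum.inr k), fun _ => isHomogeneous_X _ _, fun M N k => by simp⟩

theorem const (F : MvPolynomial (Fin 2) ℂ) : HasPolynomialCoeffs a b 0 fun _ _ => F :=
  ⟨fun k => C (coeff k F), fun _ => isHomogeneous_C _ _, fun M N k => by simp⟩

theorem mul (h : HasPolynomialCoeffs a b n Ψ) (h' : HasPolynomialCoeffs a b n' Ψ') :
    HasPolynomialCoeffs a b (n + n') fun M N => Ψ M N * Ψ' M N := by
  obtain ⟨P, hP, hP'⟩ := h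
  obtain ⟨Q, hQ, hQ'⟩ := h'
  refine ⟨fun k => ∑ x ∈ Finset.HasAntidiagonal.antidiagonal k, P x.1 * Q x.2,
    fun k => IsHomogeneous.sum _ _ _ fun x _ => (hP _).mul (hQ _), fun M N k => ?_⟩
  simp only [coeff_mul, hP', hQ', map_sum, map_mul]

theorem sum {ι : Type*} {s : Finset ι} {Ψ : ι → S a → S b → MvPolynomial (Fin 2) ℂ}
    (h : ∀ i ∈ s, HasPolynomialCoeffs a b n (Ψ i)) :
    HasPolynomialCoeffs a b n fun M N => ∑ i ∈ s, Ψ i M N := by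
  choose! P hP hP' using h
  refine ⟨fun k => ∑ i ∈ s, P i k, fun k => IsHomogeneous.sum _ _ _ fun i hi => hP i hi k,
    fun M N k => ?_⟩
  rw [coeff_sum, map_sum]
  exact Finset.sum_congr rfl fun i hi => hP' i hi M N k

theorem smul (h : HasPolynomialCoeffs a b n Ψ) (c : ℂ) :
    HasPolynomialCoeffs a b n fun M N => c • Ψ M N := by
  have h1 := (const (C c)).mul h
  rw [zero_add] at h1
  simpa only [smul_eq_C_mul] using h1

theorem sub (h : HasPolynomialCoeffs a b n Ψ) (h' : HasPolynomialCoeffs a b n Ψ') :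
    HasPolynomialCoeffs a b n fun M N => Ψ M N - Ψ' M N := by
  obtain ⟨P, hP, hP'⟩ := h
  obtain ⟨Q, hQ, hQ'⟩ := h'
  exact ⟨fun k => P k - Q k, fun k => (hP k).sub (hQ k), fun M N k => by
    rw [coeff_sub, hP', hQ', map_sub]⟩

theorem prod {ι : Type*} {s : Finset ι} {Ψ : ι → S a → S b → MvPolynomial (Fin 2) ℂ}
    (h : ∀ i, HasPolynomialCoeffs a b 1 (Ψ i)) :
    HasPolynomialCoeffs a b s.card fun M N => ∏ i ∈ s, Ψ i M N := by
  classical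
  induction s using Finset.induction_on with
  | empty => simpa using const 1
  | insert i s hi ih =>
    simp only [Finset.prod_insert hi, Finset.card_insert_of_notMem hi]
    rw [add_comm]
    exact (h i).mul ih

theorem pderiv (h : HasPolynomialCoeffs a b n Ψ) (i : Fin 2) :
    HasPolynomialCoeffs a b n fun M N => MvPolynomial.pderiv i (Ψ M N) := by
  obtain ⟨P, hP, hP'⟩ := h
  refine ⟨fun k => P (k + Finsupp.single i 1) * C (k i + 1 : ℂ),
    fun k => (hP _).mul (isHomogeneous_C _ _), fun M N k => ?_⟩
  rw [coeff_pderiv, hP', map_mul, eval_C]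

theorem partialD (h : HasPolynomialCoeffs a b n Ψ) (k l : ℕ) :
    HasPolynomialCoeffs a b n fun M N => BinaryForms.partialD k l (Ψ M N) := by
  induction k with
  | zero =>
    induction l with
    | zero => simpa only [partialD_zero_zero] using h
    | succ l ih => simpa only [pderiv_one_partialD] using ih.pderiv 1
  | succ k ih => simpa only [pderiv_zero_partialD] using ih.pderiv 0

theorem transvectant (h : HasPolynomialCoeffs a b n Ψ) (h' : HasPolynomialCoeffs a b n' Ψ')
    (e f r : ℕ) :
    HasPolynomialCoeffs a b (n + n') fun M N => BinaryForms.transvectant e f r (Ψ M N) (Ψ' M N) :=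
  (sum fun i _ => ((h.partialD (r - i) i).mul (h'.partialD i (r - i))).smul _).smul _

theorem wronskian {q : ℕ} {Ψ : Fin q → S a → S b → MvPolynomial (Fin 2) ℂ}
    (h : ∀ i, HasPolynomialCoeffs a b 1 (Ψ i)) :
    HasPolynomialCoeffs a b q fun M N => BinaryForms.wronskian fun i => Ψ i M N := by
  simp only [BinaryForms.wronskian, Matrix.det_apply, Units.smul_def, ← Int.cast_smul_eq_zsmul ℂ]
  refine sum fun σ _ => smul ?_ _
  have h1 := prod (s := Finset.univ) fun j : Fin q => (h (σ j)).partialD (q - 1 - (j : ℕ)) j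
  rw [Finset.card_univ, Fintype.card_fin] at h1
  exact h1

end HasPolynomialCoeffs

/-- `psi` is linear in the pair `(M, N)`, a Wronskian of `d` such forms has degree `d`, and the
monomials contribute degree 0. -/
theorem hasPolynomialCoeffs_Phi (d : ℕ) (hd : 3 ≤ d) (r : ℕ) :
    HasPolynomialCoeffs (2 * d - 2) (2 * d - 6) d (Phi d hd r) := by
  refine HasPolynomialCoeffs.sum fun i _ => ?_
  refine HasPolynomialCoeffs.transvectant (n' := 0) ?_ (HasPolynomialCoeffs.const _) _ _ _
  have h : HasPolynomialCoeffs (2 * d - 2) (2 * d - 6) (0 + d) fun M N => w d hd M N i := by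
    refine (HasPolynomialCoeffs.const _).mul (HasPolynomialCoeffs.wronskian fun s => ?_)
    exact (HasPolynomialCoeffs.fst.transvectant (HasPolynomialCoeffs.const _) _ _ _).sub
      ((HasPolynomialCoeffs.snd.mul (HasPolynomialCoeffs.const _)).smul _)
  rwa [zero_add] at h

end

/-! ### The action of `SL₂(ℂ)` on forms and on Cayley's operator. -/

section

/-- The chain rule for a linear substitution. -/
theorem pderiv_linear_subst {σ : Type*} [Fintype σ] (G : σ → σ → ℂ) (i : σ)
    (T : MvPolynomial σ ℂ) :
    pderiv i (aeval (fun j => ∑ l, C (G l j) * X l) T) =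
      ∑ j, C (G i j) * aeval (fun j => ∑ l, C (G l j) * X l) (pderiv j T) := by
  classical
  have hX : ∀ k, pderiv i (∑ l, C (G l k) * X l : MvPolynomial σ ℂ) = C (G i k) := by
    intro k
    simp [pderiv_X, Pi.single_apply]
  induction T using MvPolynomial.induction_on with
  | C a => simp [algebraMap_eq]
  | add p q hp hq => simp only [map_add, hp, hq, mul_add, Finset.sum_add_distrib]
  | mul_X p k hp =>
    simp only [map_mul, aeval_X, pderiv_mul, hp, hX, map_add, pderiv_X, Pi.single_apply, mul_add,
      Finset.sum_add_distrib]
    congr 1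
    · rw [Finset.sum_mul]
      exact Finset.sum_congr rfl fun j _ => by ring
    · rw [Finset.sum_eq_single k]
      · simp [mul_comm]
      · intro j _ hj
        simp [hj.symm]
      · simp

variable (g : Matrix.SpecialLinearGroup (Fin 2) ℂ)

theorem pderiv_act (i : Fin 2) (F : MvPolynomial (Fin 2) ℂ) :
    pderiv i (act g F) =
      C ((g : Matrix (Fin 2) (Fin 2) ℂ) i 0) * act g (pderiv 0 F) +
        C ((g : Matrix (Fin 2) (Fin 2) ℂ) i 1) * act g (pderiv 1 F) := by
  refine (pderiv_linear_subst _ i F).trans ?_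
  rw [Fin.sum_univ_two]
  rfl

theorem act_X (j : Fin 2) : act g (X j) =
    ∑ i, C ((g : Matrix (Fin 2) (Fin 2) ℂ) i j) * X i := aeval_X _ _

theorem act_mul (h : Matrix.SpecialLinearGroup (Fin 2) ℂ) (F : MvPolynomial (Fin 2) ℂ) :
    act (g * h) F = act g (act h F) := by
  have : act (g * h) = (act g).comp (act h) := by
    refine algHom_ext fun j => ?_
    rw [AlgHom.comp_apply, act_X, act_X]
    simp only [Fin.sum_univ_two, map_add, map_mul, act_X, algHom_C, algebraMap_eq,
      Matrix.SpecialLinearGroup.coe_mul, Matrix.mul_apply]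
    ring
  exact DFunLike.congr_fun this F

theorem act_one (F : MvPolynomial (Fin 2) ℂ) : act 1 F = F := by
  have : act 1 = AlgHom.id ℂ _ := by
    refine algHom_ext fun j => ?_
    rw [act_X]
    fin_cases j <;> simp
  exact DFunLike.congr_fun this F

/-- The diagonal action on polynomials in two pairs of variables. -/
def actTwo : MvPolynomial (Fin 2 ⊕ Fin 2) ℂ →ₐ[ℂ] MvPolynomial (Fin 2 ⊕ Fin 2) ℂ :=
  aeval fun j => ∑ l, C (Matrix.fromBlocks (g : Matrix (Fin 2) (Fin 2) ℂ) 0 0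
    (g : Matrix (Fin 2) (Fin 2) ℂ) l j) * X l

theorem actTwo_inX (E : MvPolynomial (Fin 2) ℂ) : actTwo g (inX E) = inX (act g E) := by
  have : (actTwo g).comp (rename Sum.inl) = (rename Sum.inl).comp (act g) :=
    algHom_ext fun j => by simp [actTwo, act]
  exact DFunLike.congr_fun this E

theorem actTwo_inY (E : MvPolynomial (Fin 2) ℂ) : actTwo g (inY E) = inY (act g E) := by
  have : (actTwo g).comp (rename Sum.inr) = (rename Sum.inr).comp (act g) :=
    algHom_ext fun j => by simp [actTwo, act]
  exact DFunLike.congr_fun this E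

theorem diag_actTwo (T : MvPolynomial (Fin 2 ⊕ Fin 2) ℂ) :
    diag (actTwo g T) = act g (diag T) := by
  have : diag.comp (actTwo g) = (act g).comp diag := by
    refine algHom_ext fun j => ?_
    rcases j with j | j <;> simp [actTwo, act, diag, algebraMap_eq]
  exact DFunLike.congr_fun this T

theorem pderiv_inl_actTwo (i : Fin 2) (T : MvPolynomial (Fin 2 ⊕ Fin 2) ℂ) :
    pderiv (Sum.inl i) (actTwo g T) =
      C ((g : Matrix (Fin 2) (Fin 2) ℂ) i 0) * actTwo g (pderiv (Sum.inl 0) T) +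
        C ((g : Matrix (Fin 2) (Fin 2) ℂ) i 1) * actTwo g (pderiv (Sum.inl 1) T) := by
  refine (pderiv_linear_subst _ (Sum.inl i) T).trans ?_
  simp [Fintype.sum_sum_type, Fin.sum_univ_two, actTwo]

theorem pderiv_inr_actTwo (i : Fin 2) (T : MvPolynomial (Fin 2 ⊕ Fin 2) ℂ) :
    pderiv (Sum.inr i) (actTwo g T) =
      C ((g : Matrix (Fin 2) (Fin 2) ℂ) i 0) * actTwo g (pderiv (Sum.inr 0) T) +
        C ((g : Matrix (Fin 2) (Fin 2) ℂ) i 1) * actTwo g (pderiv (Sum.inr 1) T) := by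
  refine (pderiv_linear_subst _ (Sum.inr i) T).trans ?_
  simp [Fintype.sum_sum_type, Fin.sum_univ_two, actTwo]

/-- By the chain rule `cayley` is multiplied by `det g`, which is 1. -/
theorem cayley_actTwo (T : MvPolynomial (Fin 2 ⊕ Fin 2) ℂ) :
    cayley (actTwo g T) = actTwo g (cayley T) := by
  have hdet := g.det_coe
  rw [Matrix.det_fin_two] at hdet
  have hC := congrArg (C : ℂ → MvPolynomial (Fin 2 ⊕ Fin 2) ℂ) hdet
  simp only [C_sub, C_mul, C_1] at hC
  simp only [cayley_apply, pderiv_inl_actTwo, pderiv_inr_actTwo, map_add, pderiv_C_mul, map_sub]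
  linear_combination (actTwo g (pderiv (Sum.inl 0) (pderiv (Sum.inr 1) T)) -
    actTwo g (pderiv (Sum.inl 1) (pderiv (Sum.inr 0) T))) * hC

theorem cayley_pow_actTwo (r : ℕ) (T : MvPolynomial (Fin 2 ⊕ Fin 2) ℂ) :
    (cayley ^ r) (actTwo g T) = actTwo g ((cayley ^ r) T) := by
  induction r with
  | zero => rfl
  | succ r ih => rw [pow_succ', Module.End.mul_apply, ih, cayley_actTwo, Module.End.mul_apply]

theorem rawTransvectant_act (r : ℕ) (E F : MvPolynomial (Fin 2) ℂ) :
    rawTransvectant r (act g E) (act g F) = act g (rawTransvectant r E F) := by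
  rw [← diag_cayley_pow_inX_mul_inY, ← actTwo_inX, ← actTwo_inY, ← map_mul, cayley_pow_actTwo,
    diag_actTwo, diag_cayley_pow_inX_mul_inY]

theorem psi_act {d : ℕ} {hd : 3 ≤ d} (M : S (2 * d - 2)) (N : S (2 * d - 6)) (F : S d) :
    psi d hd (actS g M) (actS g N) (actS g F) = actS g (psi d hd M N F) := by
  ext1
  change transvectant (2 * d - 2) d 2 (act g M) (act g F) - _ • (act g N * act g F) =
    act g (transvectant (2 * d - 2) d 2 M F - _ • (N * F))
  rw [transvectant_eq, rawTransvectant_act, map_sub, map_smul, map_mul, transvectant_eq, map_smul]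

/-- The action of `g` on `S_e` as a linear map. -/
def actL (e : ℕ) : S e →ₗ[ℂ] S e where
  toFun := actS g
  map_add' F G := by ext1; simp [actS]
  map_smul' c F := by ext1; simp [actS]

/-- The determinant is a homomorphism from a perfect group to a commutative one, hence trivial. -/
theorem det_actL (e : ℕ) : LinearMap.det (actL g e) = 1 := by
  let δ : Matrix.SpecialLinearGroup (Fin 2) ℂ →* ℂ :=
    { toFun := fun g => LinearMap.det (actL g e)
      map_one' := by
        have : actL 1 e = LinearMap.id := LinearMap.ext fun F => Subtype.ext (act_one _)
        rw [this, LinearMap.det_id]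
      map_mul' := fun g h => by
        have : actL (g * h) e = actL g e ∘ₗ actL h e :=
          LinearMap.ext fun F => Subtype.ext (act_mul g h _)
        rw [this, LinearMap.det_comp] }
  have h1 : δ.toHomUnits g = 1 := by
    rw [← MonoidHom.mem_ker]
    refine Abelianization.commutator_subset_ker _ ?_
    rw [Matrix.SL2.commutator_eq_top (a := (2 : ℂ)) two_ne_zero (by norm_num)]
    trivial
  exact congrArg Units.val h1

end

/-! ### Equivariance of the Wronskian and of `Phi`. -/

section

/-- The constant coefficient differential operator `p(∂)`. -/
def diffOp : MvPolynomial (Fin 2) ℂ →ₗ[ℂ] MvPolynomial (Fin 2) ℂ →ₗ[ℂ] MvPolynomial (Fin 2) ℂ :=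
  (basisMonomials (Fin 2) ℂ).constr ℂ fun k => partialD (k 0) (k 1)

theorem diffOp_monomial (k : Fin 2 →₀ ℕ) : diffOp (monomial k 1) = partialD (k 0) (k 1) := by
  have h := (basisMonomials (Fin 2) ℂ).constr_basis ℂ (fun k => partialD (k 0) (k 1)) k
  rwa [coe_basisMonomials] at h

theorem diffOp_mul_X (p G : MvPolynomial (Fin 2) ℂ) (i : Fin 2) :
    diffOp (p * X i) G = pderiv i (diffOp p G) := by
  induction p using MvPolynomial.induction_on' with
  | monomial k a =>
    have h : (monomial k a : MvPolynomial (Fin 2) ℂ) = a • monomial k 1 := by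
      rw [smul_monomial, smul_eq_mul, mul_one]
    rw [h, smul_mul_assoc, map_smul, map_smul, LinearMap.smul_apply, LinearMap.smul_apply,
      Derivation.map_smul, X, monomial_mul, mul_one, diffOp_monomial, diffOp_monomial]
    fin_cases i
    · simp [pderiv_zero_partialD]
    · simp [pderiv_one_partialD]
  | add p q hp hq => simp only [add_mul, map_add, LinearMap.add_apply, hp, hq]

variable (g : Matrix.SpecialLinearGroup (Fin 2) ℂ)

/-- Gradients transform contragrediently to the variables: the chain rule moves `g` past `∂_i` at
the price of substituting its transpose in the symbol `p`. -/
theorem diffOp_act (p G : MvPolynomial (Fin 2) ℂ) :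
    diffOp p (act g G) = act g (diffOp (act g.transpose p) G) := by
  induction p using MvPolynomial.induction_on with
  | C a =>
    have h : ∀ F, diffOp (C a) F = a • F := by
      intro F
      have h1 : (C a : MvPolynomial (Fin 2) ℂ) = a • monomial 0 1 := by
        rw [smul_monomial, smul_eq_mul, mul_one]
        rfl
      rw [h1, map_smul, LinearMap.smul_apply, diffOp_monomial]
      simp [partialD_zero_zero]
    rw [h, algHom_C, algebraMap_eq, h, map_smul]
  | add p q hp hq => simp only [map_add, LinearMap.add_apply, hp, hq]
  | mul_X p i hp =>
    rw [diffOp_mul_X, hp, pderiv_act, map_mul, act_X, Fin.sum_univ_two, ← diffOp_mul_X,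
      ← diffOp_mul_X, mul_add, map_add, LinearMap.add_apply, map_add]
    simp only [← smul_eq_C_mul, mul_smul_comm, map_smul, LinearMap.smul_apply]
    rfl

/-- Derivatives of order `n` have the monomials of `S_n` as symbols, so they are mixed by the matrix
of the transpose of `g` on `S_n`. -/
theorem partialD_act (n : ℕ) (s : Fin (n + 1)) (G : MvPolynomial (Fin 2) ℂ) :
    partialD s (n - s) (act g G) = ∑ t : Fin (n + 1),
      act g (partialD t (n - t) G) *
        C (LinearMap.toMatrix (formBasis n) (formBasis n) (actL g.transpose n) t s) := by
  have hb : ∀ t : Fin (n + 1), diffOp (basisForm n t : MvPolynomial (Fin 2) ℂ) =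
      partialD t (n - t) := by
    intro t
    rw [basisForm_eq_monomial, diffOp_monomial, expo_zero, expo_one]
  have h1 : (act g.transpose (basisForm n s) : MvPolynomial (Fin 2) ℂ) =
      ∑ t, LinearMap.toMatrix (formBasis n) (formBasis n) (actL g.transpose n) t s •
        (basisForm n t : MvPolynomial (Fin 2) ℂ) := by
    have h2 := congrArg Subtype.val ((formBasis n).sum_repr (actL g.transpose n (formBasis n s)))
    simp only [AddSubmonoidClass.coe_finsetSum, SetLike.val_smul, formBasis_apply] at h2
    simp only [LinearMap.toMatrix_apply, formBasis_apply]
    exact h2.symm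
  rw [← hb, diffOp_act, h1]
  simp only [map_sum, map_smul, LinearMap.sum_apply, LinearMap.smul_apply, hb]
  exact Finset.sum_congr rfl fun t _ => by rw [smul_eq_C_mul, mul_comm]

/-- The columns are the derivatives of order `n`, so they undergo a change of basis of `S_n` with
determinant 1. -/
theorem wronskian_act {n : ℕ} (F : Fin (n + 1) → MvPolynomial (Fin 2) ℂ) :
    wronskian (fun i => act g (F i)) = act g (wronskian F) := by
  set K := LinearMap.toMatrix (formBasis n) (formBasis n) (actL g.transpose n) with hK
  -- The reversal appears because column `j` counts derivatives in `x₁`, while `formBasis` is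
  -- indexed by the exponent of `x₀`.
  have hdet : ((K.map (C : ℂ → MvPolynomial (Fin 2) ℂ)).submatrix Fin.revPerm Fin.revPerm).det
      = 1 := by
    rw [Matrix.det_submatrix_equiv_self]
    have h := (RingHom.map_det (C : ℂ →+* MvPolynomial (Fin 2) ℂ) K).symm
    rw [RingHom.mapMatrix_apply] at h
    rw [h, hK, LinearMap.det_toMatrix, det_actL, C_1]
  have hmat : (Matrix.of fun i j : Fin (n + 1) =>
      partialD (n + 1 - 1 - (j : ℕ)) (j : ℕ) (act g (F i))) =
      (act g).mapMatrix (Matrix.of fun i j : Fin (n + 1) =>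
        partialD (n + 1 - 1 - (j : ℕ)) (j : ℕ) (F i)) *
      (K.map (C : ℂ → MvPolynomial (Fin 2) ℂ)).submatrix Fin.revPerm Fin.revPerm := by
    ext1 i j
    have h := partialD_act g n j.rev (F i)
    rw [Matrix.mul_apply, ← Equiv.sum_comp Fin.revPerm]
    have hj : ∀ t : Fin (n + 1), (t.rev : ℕ) = n - t := fun t => by rw [Fin.val_rev]; omega
    have hj' : ∀ t : Fin (n + 1), n - (t.rev : ℕ) = t := fun t => by rw [Fin.val_rev]; omega
    simp only [Matrix.of_apply, AlgHom.mapMatrix_apply, Matrix.map_apply, Matrix.submatrix_apply,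
      Fin.revPerm_apply, Fin.rev_rev, Nat.add_sub_cancel, hj'] at h ⊢
    rw [hj j] at h
    simpa only [hj] using h
  rw [wronskian, hmat, Matrix.det_mul, hdet, mul_one, ← AlgHom.map_det, wronskian]

/-- The tensor `∑ i, ± Θ(⋀_{s ≠ i} ψ(F_s)) ⊗ F_i`. -/
def wronskianTensor {d : ℕ} (hd : 3 ≤ d) (M : S (2 * d - 2)) (N : S (2 * d - 6))
    (F : Fin (d + 1) → S d) : MvPolynomial (Fin 2 ⊕ Fin 2) ℂ :=
  ∑ i : Fin (d + 1), (-1) ^ (i : ℕ) * inY (F i) *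
    inX (wronskian fun s : Fin d => (psi d hd M N (F (i.succAbove s)) : MvPolynomial (Fin 2) ℂ))

theorem wTensor_eq {d : ℕ} (hd : 3 ≤ d) (M : S (2 * d - 2)) (N : S (2 * d - 6)) :
    wTensor d hd M N = wronskianTensor hd M N (basisForm d) := by
  refine Finset.sum_congr rfl fun i _ => ?_
  rw [w]
  simp only [inX, map_mul, map_pow, map_neg, map_one]
  ring

/-- The matrix of `wronskianTensor`. -/
def tensorMatrix {d : ℕ} (hd : 3 ≤ d) (M : S (2 * d - 2)) (N : S (2 * d - 6))
    (F : Fin (d + 1) → S d) :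
    Matrix (Fin (d + 1)) (Fin (d + 1)) (MvPolynomial (Fin 2 ⊕ Fin 2) ℂ) :=
  Matrix.of fun s => Fin.cons (inY (F s)) fun j : Fin d =>
    inX (partialD (d - 1 - (j : ℕ)) (j : ℕ) (psi d hd M N (F s) : MvPolynomial (Fin 2) ℂ))

/-- Laplace expansion along the column of the `F s (y)`; this accounts for the signs in `w`. -/
theorem wronskianTensor_eq_det {d : ℕ} (hd : 3 ≤ d) (M : S (2 * d - 2)) (N : S (2 * d - 6))
    (F : Fin (d + 1) → S d) : wronskianTensor hd M N F = (tensorMatrix hd M N F).det := by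
  rw [Matrix.det_succ_column_zero]
  refine Finset.sum_congr rfl fun i _ => ?_
  congr 1
  rw [wronskian, inX, AlgHom.map_det]
  rfl

/-- Row `s` is linear in `F s`, so a change of basis acts by multiplication on the left. -/
theorem tensorMatrix_sum {d : ℕ} (hd : 3 ≤ d) (M : S (2 * d - 2)) (N : S (2 * d - 6))
    (F : Fin (d + 1) → S d) (H : Matrix (Fin (d + 1)) (Fin (d + 1)) ℂ) :
    tensorMatrix hd M N (fun s => ∑ t, H t s • F t) =
      (H.map (C : ℂ → MvPolynomial (Fin 2 ⊕ Fin 2) ℂ)).transpose * tensorMatrix hd M N F := by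
  ext1 s j
  rw [Matrix.mul_apply]
  refine Fin.cases ?_ (fun j => ?_) j
  · simp [tensorMatrix, inY, smul_eq_C_mul]
  · simp [tensorMatrix, inX, ← smul_eq_C_mul]

/-- A change of basis alters the tensor only by its determinant, so the monomials may be replaced by
their images under `g`. Then every ingredient is transformed by `g`, and `psi_act` and
`wronskian_act` apply. -/
theorem wTensor_act {d : ℕ} (hd : 3 ≤ d) (M : S (2 * d - 2)) (N : S (2 * d - 6)) :
    wTensor d hd (actS g M) (actS g N) = actTwo g (wTensor d hd M N) := by
  set H := LinearMap.toMatrix (formBasis d) (formBasis d) (actL g d) with hH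
  have hdet : (H.map (C : ℂ → MvPolynomial (Fin 2 ⊕ Fin 2) ℂ)).det = 1 := by
    have h := (RingHom.map_det (C : ℂ →+* MvPolynomial (Fin 2 ⊕ Fin 2) ℂ) H).symm
    rw [RingHom.mapMatrix_apply] at h
    rw [h, hH, LinearMap.det_toMatrix, det_actL, C_1]
  have h1 : (fun s => actS g (basisForm d s)) = fun s => ∑ t, H t s • basisForm d t := by
    ext1 s
    have h2 := (formBasis d).sum_repr (actL g d (formBasis d s))
    simp only [formBasis_apply] at h2
    simp only [hH, LinearMap.toMatrix_apply, formBasis_apply]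
    exact h2.symm
  have h2 : wronskianTensor hd (actS g M) (actS g N) (fun s => actS g (basisForm d s)) =
      wronskianTensor hd (actS g M) (actS g N) (basisForm d) := by
    rw [wronskianTensor_eq_det, h1, tensorMatrix_sum, Matrix.det_mul, Matrix.det_transpose, hdet,
      one_mul, wronskianTensor_eq_det]
  rw [wTensor_eq, wTensor_eq, ← h2]
  simp only [wronskianTensor, psi_act, map_sum, map_mul, map_pow, map_neg, map_one, actTwo_inX,
    actTwo_inY]
  obtain ⟨n, rfl⟩ : ∃ n, d = n + 1 := ⟨d - 1, by omega⟩
  refine Finset.sum_congr rfl fun i _ => ?_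
  rw [← wronskian_act]
  rfl

theorem Phi_act {d : ℕ} (hd : 3 ≤ d) (r : ℕ) (M : S (2 * d - 2)) (N : S (2 * d - 6)) :
    Phi d hd r (actS g M) (actS g N) = act g (Phi d hd r M N) := by
  rw [Phi_eq, Phi_eq, wTensor_act, cayley_pow_actTwo, diag_actTwo, map_smul]

theorem isJointCovariant_Phi {d : ℕ} (hd : 3 ≤ d) {r : ℕ} (hr : r ≤ d) :
    IsJointCovariant (2 * d - 2) (2 * d - 6) d (d * (2 * d - 4) - 2 * r) (Phi d hd r) where
  order _ _ := Phi_mem hr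
  degree := hasPolynomialCoeffs_Phi d hd r
  equivariant g M N := Phi_act g hd r M N

end

end BinaryForms

end

theorem mainTheorem5 (d : ℕ) (hd : 3 ≤ d) :
    (∀ r : ℕ, r ≤ d →
      BinaryForms.IsJointCovariant (2 * d - 2) (2 * d - 6) d (d * (2 * d - 4) - 2 * r)
        (BinaryForms.Phi d hd r)) ∧
    ∀ (M : BinaryForms.S (2 * d - 2)) (N : BinaryForms.S (2 * d - 6)), M ≠ 0 →
      List.TFAE [
        ∃ A B : BinaryForms.S d, LinearIndependent ℂ ![A, B] ∧
          (M : MvPolynomial (Fin 2) ℂ) = BinaryForms.transvectant d d 1 A B ∧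
          (N : MvPolynomial (Fin 2) ℂ) = BinaryForms.transvectant d d 3 A B,
        ∃ A B : BinaryForms.S d, LinearIndependent ℂ ![A, B] ∧
          BinaryForms.omega ^ 4 ∣ BinaryForms.bezoutiant A B -
            (BinaryForms.cConst d 0 • BinaryForms.symPolar M +
              BinaryForms.cConst d 1 • (BinaryForms.omega ^ 2 * BinaryForms.symPolar N)),
        2 ≤ Module.finrank ℂ (LinearMap.ker (BinaryForms.psi d hd M N)),
        ∀ r : ℕ, r ≤ d → BinaryForms.Phi d hd r M N = 0] ∧
      (2 ≤ Module.finrank ℂ (LinearMap.ker (BinaryForms.psi d hd M N)) →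
        Module.finrank ℂ (LinearMap.ker (BinaryForms.psi d hd M N)) = 2) := by
  refine ⟨fun r hr => BinaryForms.isJointCovariant_Phi hd hr, fun M N hM => ⟨?_, fun h => ?_⟩⟩
  · tfae_have 1 ↔ 2 := by simp only [BinaryForms.omega_pow_four_dvd_iff hd]
    tfae_have 1 ↔ 3 := by
      obtain ⟨n, rfl⟩ : ∃ n, d = n + 3 := ⟨d - 3, by omega⟩
      exact BinaryForms.transvectants_iff_finrank_ker hM
    tfae_have 3 ↔ 4 := by
      rw [BinaryForms.two_le_finrank_ker_iff, BinaryForms.Phi_eq_zero_iff]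
    tfae_finish
  · obtain ⟨n, rfl⟩ : ∃ n, d = n + 3 := ⟨d - 3, by omega⟩
    exact le_antisymm (BinaryForms.finrank_ker_psi_le hM) h
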